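/- For a compact metric space $Z$, let $\mathcal H(Z)$ be the group of homeomorphisms of $Z$ with the metric $d(a,b)=\sup_z d_Z(a(z),b(z))+\sup_z d_Z(a^{-1}(z),b^{-1}(z))$. Two homeomorphisms $\alpha,\beta\in\mathcal H(Z)$ (or the systems $(Z,\alpha)$, $(Z,\beta)$) are *weakly approximately conjugate via* sequences $(\sigma_n),(\gamma_n)$ in $\mathcal H(Z)$ if $d(\sigma_n\alpha\sigma_n^{-1},\beta)\to0$ and $d(\gamma_n\beta\gamma_n^{-1},\alpha)\to0$, and *weakly approximately conjugate* if such sequences exist. The *periodic spectrum* $PS(\alpha)$ is the set of integers $p\ge1$ for which there is a clopen $U\subset Z$ with $Z=\bigsqcup_{i=0}^{p-1}\alpha^i(U)$. Let $K$ be a Cantor space and $\Omega$ a compact connected metric space, and put $X=K\times\Omega$. For $s\in\mathcal H(K)$ and a continuous map (cocycle) $c:K\to\mathcal H(\Omega)$, let $s\times c\in\mathcal H(X)$ be $(x,\omega)\mapsto(s(x),c_x(\omega))$. Call $c$ *quasi-trivial* if $c_x$ induces the identity on $K_i(C(\Omega))$ for $i=0,1$ and all $x\in K$. A set $M\subset\mathcal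 H(\Omega)$ is a *witness of the Lipschitz-minimal-property (LMP)* of $\Omega$ if, for some $\mathcal L>0$, it is a pathwise connected set of $\mathcal L$-Lipschitz homeomorphisms lying in the identity path component of $\mathcal H(\Omega)$, and for every nonempty open $O\subset\Omega$ there are finitely many $h_1,\dots,h_k\in M$ with $\bigcup_i h_i(O)=\Omega$; $\Omega$ has the LMP if it has a witness. Given a witness $M$ and a minimal $\tilde\alpha\in\mathcal H(K)$, let $\mathcal R_0(\tilde\alpha)$ be the set of all minimal homeomorphisms of the form $\tilde\alpha\times c$ in the closure, in $\mathcal H(X)$, of $$\{G^{-1}\circ(\tilde\alpha\times\mathrm{id})\circ G:\ G=\mathrm{id}_K\times g,\ g\in C(K,M)\}.$$ **Lemma 6.10 / Corollary 6.11.** Let $\Omega$ have the LMP, let $(K,\tilde\alpha)$ and $(K,\tilde\beta)$ be Cantor minimal systems, and let $\alpha\in\mathcal R_0(\tilde\alpha)$ and $\beta\in\mathcal R_0(\tilde\beta)$ (possibly formed with two different LMP witnesses $M_1,M_2$). Then the following are equivalent: 1. $(X,\alpha)$ and $(X,\beta)$ are weakly approximately conjugate; 2. $(K,\tilde\alpha)$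 and $(K,\tilde\beta)$ are weakly approximately conjugate; 3. $(X,\alpha)$ and $(X,\beta)$ are weakly approximately conjugate via some $(\sigma_n),(\gamma_n)$ such that every $\sigma_n$ and every $\gamma_n$ is of the form $s\times c$ with $s\in\mathcal H(K)$ and $c$ quasi-trivial. Moreover, $(X,\alpha)$ and $(X,\beta)$ are weakly approximately conjugate if and only if $PS(\alpha)=PS(\beta)$. -/

import Mathlib

open Filter Topology

noncomputable section

namespace ApproxConj

/-! ### The metric on the homeomorphism group -/

section HomeoMetric

variable {Z : Type*} [MetricSpace Z] [CompactSpace Z]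

/-- The homeomorphism group `H(Z)` of a compact metric space (whose group law is composition),
with the metric `d(a, b) = sup_z d(a z, b z) + sup_z d(a⁻¹ z, b⁻¹ z)`.  The distance on `C(Z, Z)`
used here is the supremum distance, see `homeo_dist_eq` below. -/
instance homeoMetricSpace : MetricSpace (Z ≃ₜ Z) where
  dist a b := dist (a : C(Z, Z)) (b : C(Z, Z)) + dist (a.symm : C(Z, Z)) (b.symm : C(Z, Z))
  dist_self a := by simp
  dist_comm a b := by simp only [dist_comm]
  dist_triangle a b c := by
    have h1 := dist_triangle (a : C(Z, Z)) (b : C(Z, Z)) (c : C(Z, Z))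
    have h2 := dist_triangle (a.symm : C(Z, Z)) (b.symm : C(Z, Z)) (c.symm : C(Z, Z))
    linarith
  eq_of_dist_eq_zero {a b} h := by
    have h1 : dist (a : C(Z, Z)) (b : C(Z, Z)) = 0 := by
      have h2 := dist_nonneg (x := (a : C(Z, Z))) (y := (b : C(Z, Z)))
      have h3 := dist_nonneg (x := (a.symm : C(Z, Z))) (y := (b.symm : C(Z, Z)))
      change dist (a : C(Z, Z)) (b : C(Z, Z)) + dist (a.symm : C(Z, Z)) (b.symm : C(Z, Z)) = 0 at h
      linarith
    ext z
    exact DFunLike.congr_fun (dist_eq_zero.mp h1) z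

theorem homeo_dist_def (a b : Z ≃ₜ Z) :
    dist a b = dist (a : C(Z, Z)) (b : C(Z, Z)) + dist (a.symm : C(Z, Z)) (b.symm : C(Z, Z)) :=
  rfl

theorem homeo_dist_eq (a b : Z ≃ₜ Z) :
    dist a b = (⨆ z, dist (a z) (b z)) + ⨆ z, dist (a.symm z) (b.symm z) := by
  rw [homeo_dist_def, ContinuousMap.dist_eq_iSup, ContinuousMap.dist_eq_iSup]
  rfl

theorem homeo_continuous_coe : Continuous fun a : Z ≃ₜ Z => (a : C(Z, Z)) := by
  refine (LipschitzWith.of_dist_le_mul (K := 1) fun a b => ?_).continuous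
  rw [homeo_dist_def, NNReal.coe_one, one_mul]
  exact le_add_of_nonneg_right dist_nonneg

theorem homeo_continuous_symm : Continuous fun a : Z ≃ₜ Z => (a.symm : C(Z, Z)) := by
  refine (LipschitzWith.of_dist_le_mul (K := 1) fun a b => ?_).continuous
  rw [homeo_dist_def, NNReal.coe_one, one_mul]
  exact le_add_of_nonneg_left dist_nonneg

end HomeoMetric

/-! ### Dynamical systems, approximate conjugacy, periodic spectrum -/

section Dynamics

variable {Z : Type*}

/-- `(Z, α)` is minimal: no nonempty proper closed subset is invariant. -/
def IsMinimalHomeo [TopologicalSpace Z] (α : Z ≃ₜ Z) : Prop :=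
  ∀ C : Set Z, IsClosed C → α '' C = C → C = ∅ ∨ C = Set.univ

/-- `(Z, α)` is unilaterally (weakly) approximately conjugate to `(Z, β)` via `σ`:
`d(σₙ ∘ α ∘ σₙ⁻¹, β) → 0`. -/
def UnilatApproxConjVia [MetricSpace Z] [CompactSpace Z] (α β : Z ≃ₜ Z) (σ : ℕ → (Z ≃ₜ Z)) :
    Prop :=
  Tendsto (fun n => dist (σ n * α * (σ n)⁻¹) β) atTop (𝓝 0)

/-- `(Z, α)` and `(Z, β)` are (bilaterally) weakly approximately conjugate via `σ`, `γ`. -/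
def WeakApproxConjVia [MetricSpace Z] [CompactSpace Z] (α β : Z ≃ₜ Z) (σ γ : ℕ → (Z ≃ₜ Z)) :
    Prop :=
  UnilatApproxConjVia α β σ ∧ UnilatApproxConjVia β α γ

/-- `(Z, α)` and `(Z, β)` are (bilaterally) weakly approximately conjugate. -/
def WeakApproxConj [MetricSpace Z] [CompactSpace Z] (α β : Z ≃ₜ Z) : Prop :=
  ∃ σ γ : ℕ → (Z ≃ₜ Z), WeakApproxConjVia α β σ γ

/-- The periodic spectrum: all `p ≥ 1` such that `Z` is the disjoint union of
`U, α(U), …, α^{p-1}(U)` for some clopen `U`. -/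
def periodicSpectrum [TopologicalSpace Z] (α : Z ≃ₜ Z) : Set ℕ :=
  {p | 0 < p ∧ ∃ U : Set Z, IsClopen U ∧ (⋃ i ∈ Finset.range p, (α ^ i) '' U) = Set.univ ∧
    ∀ i < p, ∀ j < p, i ≠ j → Disjoint ((α ^ i) '' U) ((α ^ j) '' U)}

end Dynamics

/-! ### Skew products over `K` with fibre `Ω` and the class `R₀` -/

section Skew

variable {K Ω : Type*} [MetricSpace K] [MetricSpace Ω] [CompactSpace Ω]

/-- The skew product `s × c : (x, ω) ↦ (s x, c_x ω)` on `K × Ω`, for a homeomorphism `s` of `K` and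
a continuous map (cocycle) `c : K → H(Ω)`. -/
def skewProduct (s : K ≃ₜ K) (c : C(K, Ω ≃ₜ Ω)) : K × Ω ≃ₜ K × Ω where
  toFun p := (s p.1, c p.1 p.2)
  invFun p := (s.symm p.1, (c (s.symm p.1)).symm p.2)
  left_inv p := by simp
  right_inv p := by simp
  continuous_toFun := by
    refine (s.continuous.comp continuous_fst).prodMk ?_
    have h : Continuous fun p : K × Ω => ((c p.1 : Ω ≃ₜ Ω) : C(Ω, Ω)) :=
      homeo_continuous_coe.comp (c.continuous.comp continuous_fst)
    exact h.eval continuous_snd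
  continuous_invFun := by
    refine (s.symm.continuous.comp continuous_fst).prodMk ?_
    have h : Continuous fun p : K × Ω => ((c (s.symm p.1)).symm : C(Ω, Ω)) :=
      homeo_continuous_symm.comp (c.continuous.comp (s.symm.continuous.comp continuous_fst))
    exact h.eval continuous_snd

/-- A set `M` of homeomorphisms acts minimally on `Ω`: for every nonempty open set `O` finitely many
of the images `h(O)`, `h ∈ M`, cover `Ω`. -/
def ActsMinimally (M : Set (Ω ≃ₜ Ω)) : Prop :=
  ∀ O : Set Ω, IsOpen O → O.Nonempty →
    ∃ F : Set (Ω ≃ₜ Ω), F.Finite ∧ F ⊆ M ∧ (⋃ h ∈ F, h '' O) = Set.univ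

/-- The set of `L`-Lipschitz homeomorphisms in the identity path component of `H(Ω)`. -/
def lipschitzHomeos (Ω : Type*) [MetricSpace Ω] [CompactSpace Ω] (L : ℝ) : Set (Ω ≃ₜ Ω) :=
  {h | (∀ x y, dist (h x) (h y) ≤ L * dist x y) ∧ h ∈ pathComponent (1 : Ω ≃ₜ Ω)}

/-- `M` witnesses the Lipschitz-minimal-property of `Ω`: for some `L > 0` it is a pathwise
connected set of `L`-Lipschitz homeomorphisms in the identity path component of `H(Ω)`,
acting minimally on `Ω`. -/
def IsLMPWitness (M : Set (Ω ≃ₜ Ω)) : Prop :=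
  ∃ L : ℝ, 0 < L ∧ M ⊆ lipschitzHomeos Ω L ∧ IsPathConnected M ∧ ActsMinimally M

/-- All `G⁻¹ ∘ (s × id) ∘ G` with `G = id × g` and `g : K → M` continuous. -/
def D0 (M : Set (Ω ≃ₜ Ω)) (s : K ≃ₜ K) : Set (K × Ω ≃ₜ K × Ω) :=
  {h | ∃ g : C(K, Ω ≃ₜ Ω), (∀ x, g x ∈ M) ∧
    h = (skewProduct 1 g)⁻¹ * skewProduct s (ContinuousMap.const K 1) * skewProduct 1 g}

/-- The class `R₀(s)` (formed with `M`): the minimal skew products `s × c` in the closure of `D0`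
in `H(K × Ω)`. -/
def R0 [CompactSpace K] (M : Set (Ω ≃ₜ Ω)) (s : K ≃ₜ K) : Set (K × Ω ≃ₜ K × Ω) :=
  {h | (∃ c : C(K, Ω ≃ₜ Ω), h = skewProduct s c) ∧ h ∈ closure (D0 M s) ∧ IsMinimalHomeo h}

end Skew

/-! ### The group `K₀` of a unital C*-algebra -/

section KZero

open Matrix

variable {A B : Type*} [CStarAlgebra A] [CStarAlgebra B]

/-- Murray-von Neumann equivalence of (projection) matrices of possibly different sizes:
`p = v v*` and `q = v* v` for a rectangular matrix `v`. -/
def MvN {ι κ : Type*} [Fintype ι] [Fintype κ] (p : Matrix ι ι A) (q : Matrix κ κ A) : Prop :=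
  ∃ v : Matrix ι κ A, v * vᴴ = p ∧ vᴴ * v = q

theorem eq_zero_of_mul_conjTranspose {ι κ : Type*} [Fintype κ] (w : Matrix ι κ A)
    (h : w * wᴴ = 0) : w = 0 := by
  let _ := CStarAlgebra.spectralOrder A
  let _ := CStarAlgebra.spectralOrderedRing A
  ext i j
  have h1 : ∑ k, w i k * star (w i k) = 0 := by
    have := congrFun (congrFun h i) i
    simpa [Matrix.mul_apply] using this
  have h2 := (Finset.sum_eq_zero_iff_of_nonneg fun k _ => mul_star_self_nonneg (w i k)).mp h1 j
    (Finset.mem_univ j)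
  simpa using (CStarRing.mul_star_self_eq_zero_iff _).mp h2

/-- If `v v*` is a projection `p` then `p v = v`. -/
theorem proj_mul_of_eq {ι κ : Type*} [Fintype ι] [Fintype κ] {v : Matrix ι κ A}
    {p : Matrix ι ι A} (hp : IsStarProjection p) (h : v * vᴴ = p) : p * v = v := by
  have h1 : p * p = p := hp.isIdempotentElem
  have h2 : pᴴ = p := hp.isSelfAdjoint
  have h3 : (p * v - v) * (p * v - v)ᴴ = 0 := by
    rw [conjTranspose_sub, conjTranspose_mul, h2, Matrix.sub_mul, Matrix.mul_sub, Matrix.mul_sub,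
      Matrix.mul_assoc p v, ← Matrix.mul_assoc v, h, h1, h1, Matrix.mul_assoc p v, h, h1]
    simp
  exact sub_eq_zero.mp (eq_zero_of_mul_conjTranspose _ h3)

theorem MvN.symm {ι κ : Type*} [Fintype ι] [Fintype κ] {p : Matrix ι ι A} {q : Matrix κ κ A} :
    MvN p q → MvN q p := by
  rintro ⟨v, h1, h2⟩
  exact ⟨vᴴ, by simpa using h2, by simpa using h1⟩

theorem MvN.refl {ι : Type*} [Fintype ι] {p : Matrix ι ι A} (hp : IsStarProjection p) :
    MvN p p := by
  have h1 : p * p = p := hp.isIdempotentElem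
  have h2 : pᴴ = p := hp.isSelfAdjoint
  exact ⟨p, by rw [h2, h1], by rw [h2, h1]⟩

theorem MvN.trans {ι κ μ : Type*} [Fintype ι] [Fintype κ] [Fintype μ] {p : Matrix ι ι A}
    {q : Matrix κ κ A} {r : Matrix μ μ A} (hp : IsStarProjection p) (hr : IsStarProjection r) :
    MvN p q → MvN q r → MvN p r := by
  rintro ⟨v, h1, h2⟩ ⟨w, h3, h4⟩
  refine ⟨v * w, ?_, ?_⟩
  · rw [conjTranspose_mul, Matrix.mul_assoc, ← Matrix.mul_assoc w, h3, ← h2, ← Matrix.mul_assoc,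
      ← Matrix.mul_assoc, h1, proj_mul_of_eq hp h1, h1]
  · have h5 : r * wᴴ = wᴴ := proj_mul_of_eq hr (by simpa using h4)
    rw [conjTranspose_mul, Matrix.mul_assoc, ← Matrix.mul_assoc vᴴ, h2, ← h3, ← Matrix.mul_assoc,
      ← Matrix.mul_assoc, h4, h5, h4]

theorem MvN.fromBlocks {ι κ ι' κ' : Type*} [Fintype ι] [Fintype κ] [Fintype ι'] [Fintype κ']
    {p : Matrix ι ι A} {q : Matrix κ κ A} {p' : Matrix ι' ι' A} {q' : Matrix κ' κ' A} :
    MvN p q → MvN p' q' → MvN (fromBlocks p 0 0 p') (fromBlocks q 0 0 q') := by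
  rintro ⟨v, h1, h2⟩ ⟨w, h3, h4⟩
  refine ⟨Matrix.fromBlocks v 0 0 w, ?_, ?_⟩ <;>
    simp [fromBlocks_conjTranspose, fromBlocks_multiply, h1, h2, h3, h4]

theorem MvN.submatrix {ι κ ι' κ' : Type*} [Fintype ι] [Fintype κ] [Fintype ι'] [Fintype κ']
    {p : Matrix ι ι A} {q : Matrix κ κ A} (e : ι' ≃ ι) (f : κ' ≃ κ) :
    MvN p q → MvN (p.submatrix e e) (q.submatrix f f) := by
  rintro ⟨v, h1, h2⟩
  refine ⟨v.submatrix e f, ?_, ?_⟩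
  · rw [conjTranspose_submatrix, submatrix_mul_equiv, h1]
  · rw [conjTranspose_submatrix, submatrix_mul_equiv, h2]

theorem MvN.reindex {ι κ : Type*} [Fintype ι] [Fintype κ] {p : Matrix ι ι A}
    (hp : IsStarProjection p) (e : κ ≃ ι) : MvN p (p.submatrix e e) := by
  have h1 : p * p = p := hp.isIdempotentElem
  have h2 : pᴴ = p := hp.isSelfAdjoint
  refine ⟨p.submatrix id e, ?_, ?_⟩
  · rw [conjTranspose_submatrix, submatrix_mul_equiv, h2, h1, submatrix_id_id]
  · rw [conjTranspose_submatrix, h2]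
    exact (submatrix_mul_equiv p p e (Equiv.refl ι) e).trans (by rw [h1])

theorem isStarProjection_fromBlocks {ι κ : Type*} [Fintype ι] [Fintype κ] {p : Matrix ι ι A}
    {q : Matrix κ κ A} (hp : IsStarProjection p) (hq : IsStarProjection q) :
    IsStarProjection (Matrix.fromBlocks p 0 0 q) := by
  have h1 : p * p = p := hp.isIdempotentElem
  have h2 : pᴴ = p := hp.isSelfAdjoint
  have h3 : q * q = q := hq.isIdempotentElem
  have h4 : qᴴ = q := hq.isSelfAdjoint
  refine ⟨?_, ?_⟩
  · change Matrix.fromBlocks p 0 0 q * Matrix.fromBlocks p 0 0 q = _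
    simp [fromBlocks_multiply, h1, h3]
  · change (Matrix.fromBlocks p 0 0 q)ᴴ = _
    simp [fromBlocks_conjTranspose, h2, h4]

theorem isStarProjection_submatrix {ι κ : Type*} [Fintype ι] [Fintype κ] {p : Matrix ι ι A}
    (hp : IsStarProjection p) (e : κ ≃ ι) : IsStarProjection (p.submatrix e e) := by
  have h1 : p * p = p := hp.isIdempotentElem
  have h2 : pᴴ = p := hp.isSelfAdjoint
  refine ⟨?_, ?_⟩
  · change p.submatrix e e * p.submatrix e e = _
    rw [submatrix_mul_equiv, h1]
  · change (p.submatrix e e)ᴴ = _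
    rw [conjTranspose_submatrix, h2]

theorem isStarProjection_map {ι : Type*} [Fintype ι] {p : Matrix ι ι A}
    (hp : IsStarProjection p) (φ : A →⋆ₐ[ℂ] B) : IsStarProjection (p.map φ) := by
  have h1 : p * p = p := hp.isIdempotentElem
  have h2 : pᴴ = p := hp.isSelfAdjoint
  refine ⟨?_, ?_⟩
  · change p.map φ * p.map φ = _
    rw [← Matrix.map_mul, h1]
  · change (p.map φ)ᴴ = _
    rw [← conjTranspose_map φ (fun a => map_star φ a), h2]

theorem MvN.map {ι κ : Type*} [Fintype ι] [Fintype κ] {p : Matrix ι ι A} {q : Matrix κ κ A}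
    (φ : A →⋆ₐ[ℂ] B) : MvN p q → MvN (p.map φ) (q.map φ) := by
  rintro ⟨v, h1, h2⟩
  refine ⟨v.map φ, ?_, ?_⟩
  · rw [← conjTranspose_map φ (fun a => map_star φ a), ← Matrix.map_mul, h1]
  · rw [← conjTranspose_map φ (fun a => map_star φ a), ← Matrix.map_mul, h2]

variable (A) in
/-- Projections in the matrix algebras `Mₙ(A)`, `n ≥ 0`. -/
abbrev Proj : Type _ := Σ n : ℕ, {p : Matrix (Fin n) (Fin n) A // IsStarProjection p}

variable (A) in
/-- Murray-von Neumann equivalence on `Proj A`. -/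
instance projSetoid : Setoid (Proj A) where
  r p q := MvN p.2.1 q.2.1
  iseqv :=
    { refl := fun p => MvN.refl p.2.2
      symm := fun h => h.symm
      trans := fun {p _ r} h h' => h.trans p.2.2 r.2.2 h' }

/-- The orthogonal sum `diag(p, q)`. -/
def Proj.sum (p q : Proj A) : Proj A :=
  ⟨p.1 + q.1, (Matrix.fromBlocks p.2.1 0 0 q.2.1).submatrix finSumFinEquiv.symm finSumFinEquiv.symm,
    isStarProjection_submatrix (isStarProjection_fromBlocks p.2.2 q.2.2) _⟩

/-- The image of a projection under a unital `*`-homomorphism. -/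
def Proj.map (φ : A →⋆ₐ[ℂ] B) (p : Proj A) : Proj B :=
  ⟨p.1, p.2.1.map φ, isStarProjection_map p.2.2 φ⟩

variable (A) in
/-- The monoid `V(A)` of Murray-von Neumann classes of projections in matrix algebras over `A`. -/
def VMonoid : Type _ := Quotient (projSetoid A)

theorem mvN_sum (p q : Proj A) :
    MvN (Matrix.fromBlocks p.2.1 0 0 q.2.1) (p.sum q).2.1 :=
  MvN.reindex (isStarProjection_fromBlocks p.2.2 q.2.2) _

/-- Addition in `V(A)` is the orthogonal sum. -/
instance : Add (VMonoid A) where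
  add := Quotient.map₂ Proj.sum fun _ _ h _ _ h' => (h.fromBlocks h').submatrix _ _

instance : Zero (VMonoid A) where
  zero := Quotient.mk _ ⟨0, 0, IsStarProjection.zero _⟩

instance : AddCommMonoid (VMonoid A) where
  nsmul := nsmulRec
  add_assoc := by
    rintro ⟨p⟩ ⟨q⟩ ⟨r⟩
    refine Quotient.sound ?_
    have hpq := isStarProjection_fromBlocks p.2.2 q.2.2
    have hqr := isStarProjection_fromBlocks q.2.2 r.2.2
    have h1 := (mvN_sum (p.sum q) r).symm
    have h2 := ((mvN_sum p q).symm).fromBlocks (MvN.refl r.2.2)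
    have h3 := MvN.reindex (isStarProjection_fromBlocks p.2.2 hqr) (Equiv.sumAssoc _ _ _)
    have h4 := (MvN.refl p.2.2).fromBlocks (mvN_sum q r)
    have h5 := mvN_sum p (q.sum r)
    have e : (Matrix.fromBlocks p.2.1 0 0 (Matrix.fromBlocks q.2.1 0 0 r.2.1)).submatrix
        (Equiv.sumAssoc (Fin p.1) (Fin q.1) (Fin r.1)) (Equiv.sumAssoc _ _ _) =
        Matrix.fromBlocks (Matrix.fromBlocks p.2.1 0 0 q.2.1) 0 0 r.2.1 := by
      ext ((i | i) | i) ((j | j) | j) <;> rfl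
    rw [e] at h3
    exact MvN.trans (Proj.sum _ _).2.2 (Proj.sum _ _).2.2 h1 <|
      MvN.trans (isStarProjection_fromBlocks (p.sum q).2.2 r.2.2) (Proj.sum _ _).2.2 h2 <|
      MvN.trans (isStarProjection_fromBlocks hpq r.2.2) (Proj.sum _ _).2.2 h3.symm <|
      MvN.trans (isStarProjection_fromBlocks p.2.2 hqr) (Proj.sum _ _).2.2 h4 h5
  zero_add := by
    rintro ⟨p⟩
    refine Quotient.sound ?_
    have h1 := (mvN_sum ⟨0, 0, IsStarProjection.zero _⟩ p).symm
    have h2 := MvN.reindex p.2.2 (Equiv.emptySum (Fin 0) (Fin p.1))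
    have e : p.2.1.submatrix (Equiv.emptySum (Fin 0) (Fin p.1)) (Equiv.emptySum (Fin 0) _) =
        Matrix.fromBlocks (0 : Matrix (Fin 0) (Fin 0) A) 0 0 p.2.1 := by
      ext (i | i) (j | j)
      · exact i.elim0
      · exact i.elim0
      · exact j.elim0
      · rfl
    rw [e] at h2
    exact MvN.trans (Proj.sum _ _).2.2 p.2.2 h1 h2.symm
  add_zero := by
    rintro ⟨p⟩
    refine Quotient.sound ?_
    have h1 := (mvN_sum p ⟨0, 0, IsStarProjection.zero _⟩).symm
    have h2 := MvN.reindex p.2.2 (Equiv.sumEmpty (Fin p.1) (Fin 0))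
    have e : p.2.1.submatrix (Equiv.sumEmpty (Fin p.1) (Fin 0)) (Equiv.sumEmpty _ (Fin 0)) =
        Matrix.fromBlocks p.2.1 0 0 (0 : Matrix (Fin 0) (Fin 0) A) := by
      ext (i | i) (j | j)
      · rfl
      · exact j.elim0
      · exact i.elim0
      · exact i.elim0
    rw [e] at h2
    exact MvN.trans (Proj.sum _ _).2.2 p.2.2 h1 h2.symm
  add_comm := by
    rintro ⟨p⟩ ⟨q⟩
    refine Quotient.sound ?_
    have h1 := (mvN_sum p q).symm
    have h2 := MvN.reindex (isStarProjection_fromBlocks p.2.2 q.2.2) (Equiv.sumComm _ _)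
    have e : (Matrix.fromBlocks p.2.1 0 0 q.2.1).submatrix
        (Equiv.sumComm (Fin q.1) (Fin p.1)) (Equiv.sumComm _ _) =
        Matrix.fromBlocks q.2.1 0 0 p.2.1 := by
      ext (i | i) (j | j) <;> rfl
    rw [e] at h2
    exact MvN.trans (Proj.sum _ _).2.2 (Proj.sum _ _).2.2 h1 <|
      MvN.trans (isStarProjection_fromBlocks p.2.2 q.2.2) (Proj.sum _ _).2.2 h2 (mvN_sum q p)

/-- The map `V(A) → V(B)` induced by a unital `*`-homomorphism. -/
def VMonoid.map (φ : A →⋆ₐ[ℂ] B) : VMonoid A →+ VMonoid B where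
  toFun := Quotient.map (Proj.map φ) fun _ _ h => h.map φ
  map_zero' := by
    refine congrArg (Quotient.mk _) ?_
    simp [Proj.map, Matrix.map_zero]
  map_add' := by
    rintro ⟨p⟩ ⟨q⟩
    refine congrArg (Quotient.mk _) (congrArg (Sigma.mk (p.1 + q.1)) (Subtype.ext ?_))
    change ((Matrix.fromBlocks p.2.1 0 0 q.2.1).submatrix finSumFinEquiv.symm
      finSumFinEquiv.symm).map φ = (Matrix.fromBlocks (p.2.1.map φ) 0 0 (q.2.1.map φ)).submatrix
        finSumFinEquiv.symm finSumFinEquiv.symm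
    rw [← Matrix.submatrix_map, Matrix.fromBlocks_map, Matrix.map_zero _ (map_zero φ),
      Matrix.map_zero _ (map_zero φ)]

variable (A) in
/-- `K₀(A)` of a unital C*-algebra: the Grothendieck group of `V(A)`. -/
abbrev K0 : Type _ := Algebra.GrothendieckAddGroup (VMonoid A)

/-- The map `K₀(A) → K₀(B)` induced by a unital `*`-homomorphism. -/
def K0.map (φ : A →⋆ₐ[ℂ] B) : K0 A →+ K0 B :=
  Algebra.GrothendieckAddGroup.lift (Algebra.GrothendieckAddGroup.of.comp (VMonoid.map φ))

end KZero

/-! ### The group `K₁` of a unital C*-algebra -/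

section KOne

open Matrix

variable {A B : Type*} [CStarAlgebra A] [CStarAlgebra B]

variable (A) in
/-- The unitary group `Uₙ(A)` of `Mₙ(A)`, with the (entrywise) norm topology. -/
abbrev UGrp (n : ℕ) : Type _ := unitary (Matrix (Fin n) (Fin n) A)

/-- The matrix `diag(u, 1)` of size `n ≥ m`. -/
def stabMat {m : ℕ} (n : ℕ) (u : Matrix (Fin m) (Fin m) A) : Matrix (Fin n) (Fin n) A :=
  fun i j => if h : i.1 < m ∧ j.1 < m then u ⟨i, h.1⟩ ⟨j, h.2⟩ else if i = j then 1 else 0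

theorem stabMat_one {m n : ℕ} : stabMat n (1 : Matrix (Fin m) (Fin m) A) = 1 := by
  ext i j
  by_cases h : i = j
  · subst h; simp [stabMat]
  · have : ¬ i.1 = j.1 := fun h' => h (Fin.ext h')
    simp [stabMat, h, this]

theorem stabMat_mul {m n : ℕ} (hmn : m ≤ n) (u v : Matrix (Fin m) (Fin m) A) :
    stabMat n (u * v) = stabMat n u * stabMat n v := by
  obtain ⟨k, rfl⟩ := Nat.exists_eq_add_of_le hmn
  have h1 (a : Fin m) (b : Fin k) : ¬ (a : ℕ) = m + b := by omega
  have h2 (a : Fin m) (b : Fin k) : ¬ m + (b : ℕ) = a := by omega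
  ext i j
  refine Fin.addCases (fun i => ?_) (fun i => ?_) i <;>
    refine Fin.addCases (fun j => ?_) (fun j => ?_) j <;>
    simp [stabMat, Matrix.mul_apply, Fin.sum_univ_add, Fin.ext_iff, h1, h2]
  simp [Fin.val_inj]

theorem stabMat_conjTranspose {m n : ℕ} (u : Matrix (Fin m) (Fin m) A) :
    stabMat n uᴴ = (stabMat n u)ᴴ := by
  ext i j
  simp only [stabMat, Matrix.conjTranspose_apply, and_comm, eq_comm]
  split_ifs <;> simp

/-- The embedding `Uₘ(A) → Uₙ(A)`, `u ↦ diag(u, 1)`, for `m ≤ n`. -/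
def stab {m n : ℕ} (hmn : m ≤ n) : UGrp A m →* UGrp A n where
  toFun u := ⟨stabMat n u.1, by
    have h := Unitary.mem_iff.mp u.2
    simp only [Matrix.star_eq_conjTranspose] at h
    refine Unitary.mem_iff.mpr ⟨?_, ?_⟩
    · rw [Matrix.star_eq_conjTranspose, ← stabMat_conjTranspose, ← stabMat_mul hmn, h.1,
        stabMat_one]
    · rw [Matrix.star_eq_conjTranspose, ← stabMat_conjTranspose, ← stabMat_mul hmn, h.2,
        stabMat_one]⟩
  map_one' := Subtype.ext stabMat_one
  map_mul' u v := Subtype.ext (stabMat_mul hmn u.1 v.1)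

theorem continuous_stab {m n : ℕ} (hmn : m ≤ n) : Continuous (stab (A := A) hmn) := by
  refine Continuous.subtype_mk ?_ _
  refine continuous_matrix fun i j => ?_
  by_cases h : i.1 < m ∧ j.1 < m
  · simp only [stabMat, h, and_self, dif_pos]
    exact (continuous_apply_apply _ _).comp continuous_subtype_val
  · simp only [stabMat, h, dif_neg, not_false_eq_true]
    exact continuous_const

instance : DirectedSystem (UGrp A) fun _ _ h => (stab (A := A) h : UGrp A _ → UGrp A _) where
  map_self n u := by
    refine Subtype.ext ?_
    ext i j
    simp [stab, stabMat]
  map_map n m k hkm hmn u := by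
    refine Subtype.ext ?_
    ext i j
    simp only [stab, stabMat, MonoidHom.coe_mk, OneHom.coe_mk, Fin.ext_iff]
    by_cases h : i.1 < k ∧ j.1 < k
    · simp [h, h.1.trans_le hkm, h.2.trans_le hkm]
    · by_cases h' : i.1 < m ∧ j.1 < m <;> simp [h, h']

variable (A) in
/-- The stable unitary group `U_∞(A) = ⋃ₙ Uₙ(A)`. -/
abbrev UInf : Type _ := DirectLimit (UGrp A) fun _ _ h => stab (A := A) h

/-- The class of `u ∈ Uₙ(A)` in `U_∞(A)`. -/
def UInf.mk {n : ℕ} (u : UGrp A n) : UInf A :=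
  Quotient.mk (DirectLimit.setoid fun _ _ h => stab (A := A) h) ⟨n, u⟩

theorem UInf.mk_stab {m n : ℕ} (h : m ≤ n) (u : UGrp A m) : UInf.mk (stab h u) = UInf.mk u :=
  DirectLimit.mk_apply (f := fun _ _ h => stab (A := A) h) m n u h

theorem UInf.mk_mul {n : ℕ} (u v : UGrp A n) : UInf.mk (u * v) = UInf.mk u * UInf.mk v :=
  (DirectLimit.mul_def n u v).symm

theorem UInf.exists_mk (x : UInf A) : ∃ n, ∃ u : UGrp A n, x = UInf.mk u :=
  DirectLimit.exists_eq_mk (fun _ _ h => stab (A := A) h) x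

theorem joined_mul {n : ℕ} {u v u' v' : UGrp A n} (h : Joined u v) (h' : Joined u' v') :
    Joined (u * u') (v * v') := by
  obtain ⟨p⟩ := h
  obtain ⟨q⟩ := h'
  exact ⟨⟨⟨fun t => p t * q t, p.continuous.mul q.continuous⟩, by simp, by simp⟩⟩

variable (A) in
/-- `U_∞(A)₀`: the classes of the unitaries which, in some `Uₙ(A)`, can be joined to `1` by a
path. -/
def UInf0 : Subgroup (UInf A) where
  carrier := {x | ∃ n, ∃ u : UGrp A n, Joined 1 u ∧ x = UInf.mk u}
  one_mem' := ⟨0, 1, Joined.refl _, DirectLimit.one_def 0⟩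
  mul_mem' := by
    rintro _ _ ⟨m, u, hu, rfl⟩ ⟨n, v, hv, rfl⟩
    refine ⟨max m n, stab (le_max_left m n) u * stab (le_max_right m n) v, ?_, ?_⟩
    · have h1 := hu.map (continuous_stab (A := A) (le_max_left m n))
      have h2 := hv.map (continuous_stab (A := A) (le_max_right m n))
      simpa using joined_mul h1 h2
    · rw [UInf.mk_mul, UInf.mk_stab, UInf.mk_stab]
  inv_mem' := by
    rintro _ ⟨n, u, hu, rfl⟩
    exact ⟨n, u⁻¹, by simpa using hu.map continuous_inv, rfl⟩

instance : (UInf0 A).Normal where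
  conj_mem := by
    rintro _ ⟨m, u, hu, rfl⟩ g
    obtain ⟨n, v, rfl⟩ := g.exists_mk
    refine ⟨max m n, stab (le_max_right m n) v * stab (le_max_left m n) u *
      (stab (le_max_right m n) v)⁻¹, ?_, ?_⟩
    · have h1 := hu.map (continuous_stab (A := A) (le_max_left m n))
      have h2 := joined_mul (joined_mul (Joined.refl (stab (A := A) (le_max_right m n) v)) h1)
        (Joined.refl (stab (A := A) (le_max_right m n) v)⁻¹)
      simpa using h2
    · rw [UInf.mk_mul, UInf.mk_mul, UInf.mk_stab, ← map_inv, UInf.mk_stab, UInf.mk_stab]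
      rfl

variable (A) in
/-- `K₁(A)` of a unital C*-algebra: the (abelian, here written multiplicatively) group
`U_∞(A) / U_∞(A)₀`. -/
abbrev K1 : Type _ := UInf A ⧸ UInf0 A

/-- The map `Uₙ(A) → Uₙ(B)` induced by a unital `*`-homomorphism, applied entrywise. -/
def UGrp.map (φ : A →⋆ₐ[ℂ] B) (n : ℕ) : UGrp A n →* UGrp B n where
  toFun u := ⟨u.1.map φ, by
    have h := Unitary.mem_iff.mp u.2
    simp only [Matrix.star_eq_conjTranspose] at h
    refine Unitary.mem_iff.mpr ⟨?_, ?_⟩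
    · rw [Matrix.star_eq_conjTranspose, ← conjTranspose_map φ (fun a => map_star φ a),
        ← Matrix.map_mul, h.1, Matrix.map_one φ (map_zero φ) (map_one φ)]
    · rw [Matrix.star_eq_conjTranspose, ← conjTranspose_map φ (fun a => map_star φ a),
        ← Matrix.map_mul, h.2, Matrix.map_one φ (map_zero φ) (map_one φ)]⟩
  map_one' := Subtype.ext (Matrix.map_one φ (map_zero φ) (map_one φ))
  map_mul' u v := Subtype.ext (by simp [Matrix.map_mul])

theorem UGrp.continuous_map (φ : A →⋆ₐ[ℂ] B) (n : ℕ) : Continuous (UGrp.map φ n) :=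
  Continuous.subtype_mk (continuous_subtype_val.matrix_map
    (AddMonoidHomClass.continuous_of_bound φ 1 fun a => by
      simpa using NonUnitalStarAlgHom.norm_apply_le φ a)) _

theorem UGrp.map_stab (φ : A →⋆ₐ[ℂ] B) {m n : ℕ} (h : m ≤ n) (u : UGrp A m) :
    UGrp.map φ n (stab h u) = stab h (UGrp.map φ m u) := by
  refine Subtype.ext ?_
  ext i j
  simp only [UGrp.map, stab, stabMat, MonoidHom.coe_mk, OneHom.coe_mk, Matrix.map_apply]
  split_ifs <;> simp

/-- The map `U_∞(A) → U_∞(B)` induced by a unital `*`-homomorphism. -/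
def UInf.map (φ : A →⋆ₐ[ℂ] B) : UInf A →* UInf B where
  toFun := DirectLimit.map (fun _ _ h => stab (A := A) h) (fun _ _ h => stab (A := B) h)
    (fun n => UGrp.map φ n) fun _ _ h u => (UGrp.map_stab φ h u).symm
  map_one' := by
    rw [DirectLimit.one_def 0, DirectLimit.map_def, DirectLimit.one_def 0, map_one]
  map_mul' := by
    refine DirectLimit.induction₂ _ fun n u v => ?_
    rw [DirectLimit.mul_def, DirectLimit.map_def, DirectLimit.map_def, DirectLimit.map_def,
      DirectLimit.mul_def, map_mul]

/-- The map `K₁(A) → K₁(B)` induced by a unital `*`-homomorphism. -/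
def K1.map (φ : A →⋆ₐ[ℂ] B) : K1 A →* K1 B :=
  QuotientGroup.map _ _ (UInf.map φ) (by
    rintro _ ⟨n, u, hu, rfl⟩
    exact ⟨n, UGrp.map φ n u, by simpa using hu.map (UGrp.continuous_map φ n), rfl⟩)

end KOne

/-! ### Quasi-trivial cocycles -/

section QuasiTrivial

variable {K Ω : Type*} [MetricSpace K] [MetricSpace Ω] [CompactSpace Ω]

/-- The `*`-endomorphism `f ↦ f ∘ h` of `C(Ω)`. -/
def pullback (h : Ω ≃ₜ Ω) : C(Ω, ℂ) →⋆ₐ[ℂ] C(Ω, ℂ) :=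
  ContinuousMap.compStarAlgHom' ℂ ℂ (h : C(Ω, Ω))

/-- `c : K → H(Ω)` is quasi-trivial: every `c_x` induces the identity on `K₀(C(Ω))` and
on `K₁(C(Ω))`. -/
def QuasiTrivial (c : C(K, Ω ≃ₜ Ω)) : Prop :=
  ∀ x, K0.map (pullback (c x)) = AddMonoidHom.id (K0 C(Ω, ℂ)) ∧
    K1.map (pullback (c x)) = MonoidHom.id (K1 C(Ω, ℂ))

/-- A homeomorphism of `K × Ω` of the form `s × c` with `c` quasi-trivial. -/
def HasQuasiTrivialCocycle (h : K × Ω ≃ₜ K × Ω) : Prop :=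
  ∃ (s : K ≃ₜ K) (c : C(K, Ω ≃ₜ Ω)), h = skewProduct s c ∧ QuasiTrivial c

end QuasiTrivial

end ApproxConj

end

/-! The periodic spectrum controls everything. A clopen cyclic partition of period `p` is the same
as a locally constant phase `φ` with values in `ZMod p` and `φ ∘ α = φ + 1`. Such a phase survives
small perturbations, so weak approximate conjugacy preserves the spectrum
(`WeakApproxConj.periodicSpectrum_eq`). As `Ω` is connected, phases on `K × Ω` descend to `K`, so a
skew product has the spectrum of its base (`periodicSpectrum_skewProduct`).

For Cantor minimal systems the spectrum is a complete invariant
(`approxBy_of_periodicSpectrum_subset`). Choose a clopen `B` such that `B` and `β⁻¹(B)` are both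
small, and let `S` be the finite set of its return times. The gcd of `S` is a period of `β`, hence
of `α`. Therefore `α` has a section whose first return times are exactly `S`, obtained by cutting
very tall towers into blocks with lengths in `S`. Matching the two families of towers conjugates `α`
to `β` except at the passage from tops to bases, where the error is bounded by the sizes of `B` and
`β⁻¹(B)`.

To lift to `K × Ω`, compare `α` with `α̃ × id`. Membership in `R0` makes `α` a limit of conjugates
of `α̃ × id`. The Lipschitz bound, uniform over the witness, gives the reverse approximation
(`approxBy_prodId_of_mem_R0`). All conjugating maps have cocycles with values in the identity path
component, and these act trivially on K-theory by homotopy invariance. -/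

noncomputable section

namespace ApproxConj

/-! ### The homeomorphism group as a topological group, and limits of conjugates -/

section HomeoGroup

variable {Z : Type*} [MetricSpace Z] [CompactSpace Z]

theorem homeo_continuous_iff {X : Type*} [TopologicalSpace X] {f : X → Z ≃ₜ Z} :
    Continuous f ↔ Continuous (fun x => (f x : C(Z, Z))) ∧
      Continuous fun x => ((f x).symm : C(Z, Z)) := by
  refine ⟨fun h => ⟨homeo_continuous_coe.comp h, homeo_continuous_symm.comp h⟩, fun h => ?_⟩
  rw [continuous_iff_continuousAt]
  intro x
  have h1 := tendsto_iff_dist_tendsto_zero.mp (h.1.tendsto x)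
  have h2 := tendsto_iff_dist_tendsto_zero.mp (h.2.tendsto x)
  have h3 := h1.add h2
  rw [add_zero] at h3
  exact tendsto_iff_dist_tendsto_zero.mpr h3

instance homeo_isTopologicalGroup : IsTopologicalGroup (Z ≃ₜ Z) where
  continuous_mul := by
    refine homeo_continuous_iff.mpr ⟨?_, ?_⟩
    · exact ContinuousMap.continuous_comp'.comp
        ((homeo_continuous_coe.comp continuous_snd).prodMk
          (homeo_continuous_coe.comp continuous_fst))
    · exact ContinuousMap.continuous_comp'.comp
        ((homeo_continuous_symm.comp continuous_fst).prodMk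
          (homeo_continuous_symm.comp continuous_snd))
  continuous_inv := homeo_continuous_iff.mpr ⟨homeo_continuous_symm, homeo_continuous_coe⟩

theorem dist_le_homeo_dist (a b : Z ≃ₜ Z) (z : Z) : dist (a z) (b z) ≤ dist a b :=
  (ContinuousMap.dist_apply_le_dist (f := (a : C(Z, Z))) (g := (b : C(Z, Z))) z).trans
    (le_add_of_nonneg_right dist_nonneg)

theorem dist_symm_le_homeo_dist (a b : Z ≃ₜ Z) (z : Z) :
    dist (a.symm z) (b.symm z) ≤ dist a b :=
  (ContinuousMap.dist_apply_le_dist (f := (a.symm : C(Z, Z))) (g := (b.symm : C(Z, Z))) z).trans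
    (le_add_of_nonneg_left dist_nonneg)

theorem homeo_dist_le {a b : Z ≃ₜ Z} {r s : ℝ} (hr : 0 ≤ r) (hs : 0 ≤ s)
    (h : ∀ z, dist (a z) (b z) ≤ r) (h' : ∀ z, dist (a.symm z) (b.symm z) ≤ s) :
    dist a b ≤ r + s :=
  add_le_add ((ContinuousMap.dist_le hr).mpr h) ((ContinuousMap.dist_le hs).mpr h')

/-- `β` is a limit of conjugates of `α` by elements of `S`. -/
def ApproxBy (S : Set (Z ≃ₜ Z)) (α β : Z ≃ₜ Z) : Prop :=
  β ∈ closure ((fun σ => σ * α * σ⁻¹) '' S)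

theorem approxBy_iff_exists_seq {S : Set (Z ≃ₜ Z)} {α β : Z ≃ₜ Z} :
    ApproxBy S α β ↔ ∃ σ : ℕ → (Z ≃ₜ Z), UnilatApproxConjVia α β σ ∧ ∀ n, σ n ∈ S := by
  rw [ApproxBy, mem_closure_iff_seq_limit]
  constructor
  · rintro ⟨x, hx, hlim⟩
    choose σ hσ hσ' using hx
    refine ⟨σ, ?_, hσ⟩
    have := tendsto_iff_dist_tendsto_zero.mp hlim
    simpa only [UnilatApproxConjVia, ← hσ'] using this
  · rintro ⟨σ, h, hσ⟩
    exact ⟨_, fun n => ⟨σ n, hσ n, rfl⟩, tendsto_iff_dist_tendsto_zero.mpr h⟩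

theorem approxBy_iff_forall {S : Set (Z ≃ₜ Z)} {α β : Z ≃ₜ Z} :
    ApproxBy S α β ↔ ∀ ε > 0, ∃ σ ∈ S, dist (σ * α * σ⁻¹) β < ε := by
  rw [ApproxBy, Metric.mem_closure_iff]
  simp [dist_comm]

/-- Conjugation by a fixed `τ ∈ S` is continuous and maps the `S`-conjugates of `α` to themselves,
hence also their closure. That closure therefore contains every `S`-conjugate of `β`, and all limits
of these. -/
theorem ApproxBy.trans {S : Submonoid (Z ≃ₜ Z)} {α β γ : Z ≃ₜ Z}
    (h : ApproxBy (S : Set (Z ≃ₜ Z)) α β) (h' : ApproxBy (S : Set (Z ≃ₜ Z)) β γ) :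
    ApproxBy (S : Set (Z ≃ₜ Z)) α γ := by
  refine closure_minimal ?_ isClosed_closure h'
  rintro _ ⟨τ, hτ, rfl⟩
  have hc : Continuous fun x : Z ≃ₜ Z => τ * x * τ⁻¹ := by fun_prop
  refine closure_mono ?_ (image_closure_subset_closure_image hc ⟨β, h, rfl⟩)
  rintro _ ⟨_, ⟨σ, hσ, rfl⟩, rfl⟩
  exact ⟨τ * σ, S.mul_mem hτ hσ, by simp only [mul_inv_rev, mul_assoc]⟩

end HomeoGroup

/-! ### Skew products, and the comparison of `R0` with `s × id` -/

section SkewGroup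

variable {K Ω : Type*} [MetricSpace K] [MetricSpace Ω] [CompactSpace Ω]

theorem skewProduct_apply (s : K ≃ₜ K) (c : C(K, Ω ≃ₜ Ω)) (p : K × Ω) :
    skewProduct s c p = (s p.1, c p.1 p.2) := rfl

theorem skewProduct_symm_apply (s : K ≃ₜ K) (c : C(K, Ω ≃ₜ Ω)) (p : K × Ω) :
    (skewProduct s c).symm p = (s.symm p.1, (c (s.symm p.1)).symm p.2) := rfl

theorem skewProduct_mul (s t : K ≃ₜ K) (c e : C(K, Ω ≃ₜ Ω)) :
    skewProduct s c * skewProduct t e =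
      skewProduct (s * t) (c.comp (t : C(K, K)) * e) :=
  Homeomorph.ext fun _ => rfl

theorem skewProduct_inv (s : K ≃ₜ K) (c : C(K, Ω ≃ₜ Ω)) :
    (skewProduct s c)⁻¹ = skewProduct s⁻¹ (c.comp (s.symm : C(K, K)))⁻¹ :=
  Homeomorph.ext fun _ => rfl

variable (K Ω) in
/-- The skew products `s × c` for which every `c_x` is in the identity path component. -/
def isotopicSkew : Submonoid (K × Ω ≃ₜ K × Ω) where
  carrier := {h | ∃ (s : K ≃ₜ K) (c : C(K, Ω ≃ₜ Ω)),
    h = skewProduct s c ∧ ∀ x, Joined 1 (c x)}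
  one_mem' := ⟨1, 1, rfl, fun _ => Joined.refl _⟩
  mul_mem' := by
    rintro _ _ ⟨s, c, rfl, hc⟩ ⟨t, e, rfl, he⟩
    exact ⟨s * t, _, skewProduct_mul s t c e, fun x => by simpa using (hc (t x)).mul (he x)⟩

theorem isotopicSkew_inv_mem {h : K × Ω ≃ₜ K × Ω} (hh : h ∈ isotopicSkew K Ω) :
    h⁻¹ ∈ isotopicSkew K Ω := by
  obtain ⟨s, c, rfl, hc⟩ := hh
  exact ⟨s⁻¹, _, skewProduct_inv s c, fun x => by simpa using (hc (s.symm x)).inv⟩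

/-- The product homeomorphism `s × id`. -/
def prodId (Ω : Type*) [MetricSpace Ω] [CompactSpace Ω] (s : K ≃ₜ K) : K × Ω ≃ₜ K × Ω :=
  skewProduct s (ContinuousMap.const K 1)

theorem prodId_mem (s : K ≃ₜ K) : prodId Ω s ∈ isotopicSkew K Ω :=
  ⟨s, _, rfl, fun _ => Joined.refl _⟩

variable [CompactSpace K]

theorem prodId_dist_le (s t : K ≃ₜ K) : dist (prodId Ω s) (prodId Ω t) ≤ dist s t := by
  rw [homeo_dist_def s t]
  refine homeo_dist_le dist_nonneg dist_nonneg (fun z => ?_) fun z => ?_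
  · rw [Prod.dist_eq]
    exact max_le (ContinuousMap.dist_apply_le_dist (f := (s : C(K, K))) (g := (t : C(K, K))) z.1)
      (by simp [prodId, skewProduct_apply])
  · rw [Prod.dist_eq]
    exact max_le (ContinuousMap.dist_apply_le_dist (f := (s.symm : C(K, K)))
      (g := (t.symm : C(K, K))) z.1) (by simp [prodId, skewProduct_symm_apply])

/-- The map `s ↦ s × id` respects products and inverses and does not increase distances. -/
theorem ApproxBy.prodId {s t : K ≃ₜ K} (h : ApproxBy Set.univ s t) :
    ApproxBy (isotopicSkew K Ω : Set (K × Ω ≃ₜ K × Ω)) (prodId Ω s) (prodId Ω t) := by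
  rw [approxBy_iff_forall] at h ⊢
  intro ε hε
  obtain ⟨σ, -, hσ⟩ := h ε hε
  exact ⟨ApproxConj.prodId Ω σ, prodId_mem σ, (prodId_dist_le (σ * s * σ⁻¹) t).trans_lt hσ⟩

variable {M : Set (Ω ≃ₜ Ω)} {s : K ≃ₜ K} {α : K × Ω ≃ₜ K × Ω}

theorem approxBy_of_mem_R0 (hM : IsLMPWitness M) (hα : α ∈ R0 M s) :
    ApproxBy (isotopicSkew K Ω : Set (K × Ω ≃ₜ K × Ω)) (prodId Ω s) α := by
  obtain ⟨L, -, hML, -⟩ := hM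
  refine closure_mono ?_ hα.2.1
  rintro _ ⟨g, hg, rfl⟩
  exact ⟨(skewProduct 1 g)⁻¹, isotopicSkew_inv_mem ⟨1, g, rfl, fun x => (hML (hg x)).2⟩,
    by simp only [inv_inv, prodId]⟩

/-- Let `H = G⁻¹(s × id)G` be `r`-close to `α`. At a point `G w`, comparing `GαG⁻¹` with `s × id`
means comparing `G (α w)` with `G (H w)`. Both arguments lie over the same point of `K`, where `G`
is `L`-Lipschitz. Since `G` varies with `ε`, the uniformity of `L` over `M` is what closes the
argument. -/
theorem approxBy_prodId_of_mem_R0 (hM : IsLMPWitness M) (hα : α ∈ R0 M s) :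
    ApproxBy (isotopicSkew K Ω : Set (K × Ω ≃ₜ K × Ω)) α (prodId Ω s) := by
  obtain ⟨L, hL, hML, -⟩ := hM
  obtain ⟨⟨c, rfl⟩, hcl, -⟩ := hα
  rw [approxBy_iff_forall]
  intro ε hε
  -- The factor `2` pays for the forward and the inverse supremum, each at most `L * r`.
  obtain ⟨_, ⟨g, hg, rfl⟩, hd⟩ := Metric.mem_closure_iff.mp hcl (ε / (2 * L)) (by positivity)
  set G := skewProduct (1 : K ≃ₜ K) g with hG
  have key : ∀ (x : K) (ω ω' : Ω), dist (G (x, ω)) (G (x, ω')) ≤ L * dist (x, ω) (x, ω') := by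
    intro x ω ω'
    have h1 := (hML (hg x)).1 ω ω'
    simpa [hG, skewProduct_apply, Prod.dist_eq] using h1
  refine ⟨G, ⟨1, g, rfl, fun x => (hML (hg x)).2⟩, ?_⟩
  set H : K × Ω ≃ₜ K × Ω := G⁻¹ * skewProduct s (ContinuousMap.const K 1) * G with hH
  set r := dist (skewProduct s c) H with hr
  have hr0 : 0 ≤ r := dist_nonneg
  refine (homeo_dist_le (r := L * r) (s := L * r) (by positivity) (by positivity)
    (fun z => ?_) fun z => ?_).trans_lt ?_
  · obtain ⟨w, rfl⟩ := G.surjective z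
    have h1 := dist_le_homeo_dist (skewProduct s c) H w
    have h2 : (G * skewProduct s c * G⁻¹) (G w) = G (skewProduct s c w) := by
      change G (skewProduct s c (G.symm (G w))) = _
      rw [G.symm_apply_apply]
    have h3 : prodId Ω s (G w) = G (H w) :=
      (G.apply_symm_apply _).symm
    rw [h2, h3]
    exact (key (s w.1) _ _).trans (mul_le_mul_of_nonneg_left h1 hL.le)
  · obtain ⟨w, rfl⟩ := G.surjective z
    have h1 := dist_symm_le_homeo_dist (skewProduct s c) H w
    have h2 : (G * skewProduct s c * G⁻¹).symm (G w) = G ((skewProduct s c).symm w) := by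
      change G ((skewProduct s c).symm (G.symm (G w))) = _
      rw [G.symm_apply_apply]
    have h3 : (prodId Ω s).symm (G w) = G (H.symm w) :=
      (G.apply_symm_apply _).symm
    rw [h2, h3]
    exact (key (s.symm w.1) _ _).trans (mul_le_mul_of_nonneg_left h1 hL.le)
  · rw [lt_div_iff₀ (by positivity)] at hd
    linarith

end SkewGroup

/-! ### Nearby projections are Murray–von Neumann equivalent -/

section CloseProjections

/-- The element `z = pq + (1-p)(1-q)` satisfies `pz = zq`, and `1 - z = (2p-1)(p-q)` with `2p-1`
unitary, so `z` is invertible. Its modulus commutes with `q`, so the unitary `z|z|⁻¹` intertwines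
`p` and `q`; cut it down by `p`. -/
theorem exists_partialIsometry_of_norm_sub_lt_one {B : Type*} [CStarAlgebra B] {p q : B}
    (hp : IsStarProjection p) (hq : IsStarProjection q) (hpq : ‖p - q‖ < 1) :
    ∃ v : B, v * star v = p ∧ star v * v = q := by
  let _ := CStarAlgebra.spectralOrder B
  let _ := CStarAlgebra.spectralOrderedRing B
  have hpp : p * p = p := hp.isIdempotentElem
  have hqq : q * q = q := hq.isIdempotentElem
  have hps : star p = p := hp.isSelfAdjoint
  have hqs : star q = q := hq.isSelfAdjoint
  set z : B := p * q + (1 - p) * (1 - q) with hz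
  have hpz : p * z = p * q := by
    rw [hz]
    calc p * (p * q + (1 - p) * (1 - q)) = p * p * q + (p - p * p) * (1 - q) := by noncomm_ring
      _ = p * q := by rw [hpp]; simp
  have hzq : z * q = p * q := by
    rw [hz]
    calc (p * q + (1 - p) * (1 - q)) * q = p * (q * q) + (1 - p) * (q - q * q) := by noncomm_ring
      _ = p * q := by rw [hqq]; simp
  have hzu : IsUnit z := by
    have h1 : 1 - z = (2 * p - 1) * (p - q) := by
      have : (2 * p - 1) * (p - q) = 2 * (p * p) - 2 * (p * q) - p + q := by noncomm_ring
      rw [this, hpp, hz]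
      noncomm_ring
    have h2 : ‖1 - z‖ < 1 := by
      rwa [h1, CStarRing.norm_mem_unitary_mul _ hp.two_mul_sub_one_mem_unitary]
    simpa using isUnit_one_sub_of_norm_lt_one h2
  have hsz : q * star z = star z * p := by
    have := congrArg star (hzq.trans hpz.symm)
    simpa [hps, hqs] using this
  have hcomm : Commute (CFC.abs z) q := by
    have h1 : Commute (star z * z) q := by
      change star z * z * q = q * (star z * z)
      rw [mul_assoc, hzq, ← hpz, ← mul_assoc, ← hsz, mul_assoc]
    exact Commute.cfcₙ_nnreal h1 _
  have habs : IsUnit (CFC.abs z) := by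
    rw [← isUnit_pow_iff (n := 2) two_ne_zero, CFC.abs_sq]
    exact hzu.star.mul hzu
  obtain ⟨a, ha⟩ := habs
  have haa : (a : B) * a = star z * z := by rw [ha, CFC.abs_mul_abs]
  have has : star (a : B) = a := by
    rw [ha]
    exact (CFC.abs_nonneg z).isSelfAdjoint
  have hrs : star (↑a⁻¹ : B) = ↑a⁻¹ := by
    rw [← Units.coe_star_inv]
    congr 2
    exact Units.ext has
  rw [← ha] at hcomm
  have hrq : (↑a⁻¹ : B) * q = q * ↑a⁻¹ := hcomm.units_inv_left
  set r : B := ↑a⁻¹ with hr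
  have har : (a : B) * r = 1 := a.mul_inv
  have hra : r * (a : B) = 1 := a.inv_mul
  have h3 : star z * (z * r * r) = 1 := by
    rw [← mul_assoc, ← mul_assoc, ← haa, mul_assoc (a : B), har, mul_one, har]
  have h4 : z * r * r * star z = 1 := by
    obtain ⟨w, hw⟩ := hzu.star
    have : z * r * r = ↑w⁻¹ := by
      rw [← hw] at h3
      exact (Units.inv_eq_of_mul_eq_one_right h3).symm
    rw [this, ← hw, w.inv_mul]
  refine ⟨p * z * r, ?_, ?_⟩
  · have : star (p * z * r) = r * star z * p := by simp [hps, hrs, mul_assoc]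
    rw [this]
    calc p * z * r * (r * star z * p) = p * (z * r * r * star z) * p := by noncomm_ring
      _ = p := by rw [h4, mul_one, hpp]
  · have : star (p * z * r) = r * star z * p := by simp [hps, hrs, mul_assoc]
    rw [this]
    calc r * star z * p * (p * z * r) = r * star z * (p * p * z) * r := by noncomm_ring
      _ = r * (star z * z) * (q * r) := by rw [hpp, hpz, ← hzq]; noncomm_ring
      _ = (r * a) * (a * r) * q := by rw [← haa, ← hrq]; noncomm_ring
      _ = q := by rw [hra, har]; simp

open Matrix in
-- Entrywise continuity is continuity for the C*-norm on `CStarMatrix`, where the norm estimate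
-- applies.
theorem eventually_mvN {A : Type*} [CStarAlgebra A] {n : ℕ}
    {X : Type*} [TopologicalSpace X] {P : X → Matrix (Fin n) (Fin n) A} (hP : Continuous P)
    (hproj : ∀ x, IsStarProjection (P x)) (x : X) : ∀ᶠ y in 𝓝 x, MvN (P y) (P x) := by
  let _ := CStarAlgebra.spectralOrder A
  let _ := CStarAlgebra.spectralOrderedRing A
  have hQ : Continuous fun y => CStarMatrix.ofMatrix (P y) :=
    (CStarMatrix.ofMatrixL (A := A)).continuous.comp hP
  have h1 : ∀ᶠ y in 𝓝 x, ‖CStarMatrix.ofMatrix (P y) - CStarMatrix.ofMatrix (P x)‖ < 1 := by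
    have := (hQ.sub continuous_const).norm.tendsto (f := fun y =>
      ‖CStarMatrix.ofMatrix (P y) - CStarMatrix.ofMatrix (P x)‖) x
    exact this.eventually_lt_const (by simp)
  filter_upwards [h1] with y hy
  have hp : ∀ y, IsStarProjection (CStarMatrix.ofMatrix (P y)) := fun y =>
    ⟨(hproj y).isIdempotentElem, (hproj y).isSelfAdjoint⟩
  obtain ⟨v, hv, hv'⟩ := exists_partialIsometry_of_norm_sub_lt_one (hp y) (hp x) hy
  exact ⟨CStarMatrix.ofMatrix.symm v, hv, hv'⟩

theorem mvN_of_continuous {A : Type*} [CStarAlgebra A] {n : ℕ}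
    {X : Type*} [TopologicalSpace X] [PreconnectedSpace X] {P : X → Matrix (Fin n) (Fin n) A}
    (hP : Continuous P) (hproj : ∀ x, IsStarProjection (P x)) (x y : X) : MvN (P x) (P y) := by
  have hloc : IsLocallyConstant fun x => (Quotient.mk (projSetoid A) ⟨n, P x, hproj x⟩) := by
    rw [IsLocallyConstant.iff_eventually_eq]
    intro x
    filter_upwards [eventually_mvN hP hproj x] with y hy
    exact Quotient.sound hy
  exact Quotient.exact (hloc.apply_eq_of_preconnectedSpace x y)

end CloseProjections

/-! ### Homotopy invariance of the induced maps on K-theory -/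

section Homotopy

variable {Ω : Type*} [MetricSpace Ω] [CompactSpace Ω]

theorem continuous_pullback (f : C(Ω, ℂ)) : Continuous fun h : Ω ≃ₜ Ω => pullback h f :=
  (ContinuousMap.continuous_postcomp f).comp homeo_continuous_coe

/-- Pulling a projection back along a path of homeomorphisms gives a continuous path of projections,
whose class is constant. The identity thus holds already on `VMonoid`. -/
theorem K0_map_pullback_of_joined {h : Ω ≃ₜ Ω} (hh : Joined 1 h) :
    K0.map (pullback h) = AddMonoidHom.id (K0 C(Ω, ℂ)) := by
  have key : VMonoid.map (pullback h) = AddMonoidHom.id _ := by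
    ext ⟨p⟩
    refine Quotient.sound ?_
    obtain ⟨γ⟩ := hh
    have hc : Continuous fun t => p.2.1.map (pullback (γ t)) :=
      continuous_matrix fun i j => (continuous_pullback (p.2.1 i j)).comp γ.continuous
    have h1 := mvN_of_continuous hc (fun t => isStarProjection_map p.2.2 _) 1 0
    simp only [γ.target, γ.source] at h1
    exact h1
  rw [K0.map, key]
  exact Algebra.GrothendieckAddGroup.lift.apply_symm_apply (AddMonoidHom.id _)

theorem K1_map_pullback_of_joined {h : Ω ≃ₜ Ω} (hh : Joined 1 h) :
    K1.map (pullback h) = MonoidHom.id (K1 C(Ω, ℂ)) := by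
  ext x
  obtain ⟨n, u, rfl⟩ := UInf.exists_mk x
  refine (QuotientGroup.eq.mpr ?_).symm
  obtain ⟨γ⟩ := hh
  -- Along the path `γ` from `1` to `h`, the unitaries `u⁻¹ · (u ∘ γ t)` join `1` to this element.
  refine ⟨n, u⁻¹ * UGrp.map (pullback h) n u, ?_, ?_⟩
  · have hc : Continuous fun t => UGrp.map (pullback (γ t)) n u :=
      Continuous.subtype_mk (continuous_matrix fun i j =>
        (continuous_pullback (u.1 i j)).comp γ.continuous) _
    refine ⟨⟨⟨fun t => u⁻¹ * UGrp.map (pullback (γ t)) n u, continuous_const.mul hc⟩, ?_, ?_⟩⟩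
    · simp only [γ.source]
      exact inv_mul_cancel u
    · simp only [γ.target]
  · rw [UInf.mk_mul]
    rfl

end Homotopy

theorem isotopicSkew_hasQuasiTrivialCocycle {K Ω : Type*} [MetricSpace K] [MetricSpace Ω]
    [CompactSpace Ω] {h : K × Ω ≃ₜ K × Ω} (hh : h ∈ isotopicSkew K Ω) :
    HasQuasiTrivialCocycle h := by
  obtain ⟨s, c, rfl, hc⟩ := hh
  exact ⟨s, c, rfl, fun x =>
    ⟨K0_map_pullback_of_joined (hc x), K1_map_pullback_of_joined (hc x)⟩⟩

/-! ### Homeomorphisms of Cantor spaces respecting finite clopen partitions -/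

section CantorHomeo

variable {X Y : Type*} [MetricSpace X] [CompactSpace X] [TotallyDisconnectedSpace X]
  [MetricSpace Y] [CompactSpace Y] [TotallyDisconnectedSpace Y]

theorem exists_isClopen_mem_subset {U : Set X} (hU : IsOpen U) {x : X} (hx : x ∈ U) :
    ∃ V : Set X, IsClopen V ∧ x ∈ V ∧ V ⊆ U :=
  compact_exists_isClopen_in_isOpen hU hx

/-- Cover the space by finitely many clopen sets of small diameter and colour a point by the set of
those containing it. The colours occurring on `A` are then renumbered. -/
theorem exists_coloring_fine (A : Set X) {ε : ℝ} (hε : 0 < ε) :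
    ∃ (m : ℕ) (a : X → ℕ), IsLocallyConstant a ∧ a '' A = Set.Iio m ∧
      ∀ x ∈ A, ∀ y ∈ A, a x = a y → dist x y < ε := by
  classical
  choose V hV hxV hVb using fun x : X =>
    exists_isClopen_mem_subset (Metric.isOpen_ball (x := x) (ε := ε / 2))
      (Metric.mem_ball_self (half_pos hε))
  obtain ⟨t, ht⟩ := isCompact_univ.elim_finite_subcover V (fun x => (hV x).isOpen)
    fun x _ => Set.mem_iUnion.mpr ⟨x, hxV x⟩
  let b : X → (t → Prop) := fun x i => x ∈ V i
  have hb : IsLocallyConstant b := by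
    rw [IsLocallyConstant.iff_eventually_eq]
    intro x
    have h1 : ∀ i : t, ∀ᶠ y in 𝓝 x, (y ∈ V i ↔ x ∈ V i) := by
      intro i
      by_cases hx : x ∈ V i
      · filter_upwards [(hV i).isOpen.mem_nhds hx] with y hy
        simp [hx, hy]
      · filter_upwards [(hV i).compl.isOpen.mem_nhds hx] with y hy
        simp only [hx, iff_false]
        exact hy
    filter_upwards [eventually_all.mpr h1] with y hy
    funext i
    exact propext (hy i)
  have hbd : ∀ x y, b x = b y → dist x y < ε := by
    intro x y h
    obtain ⟨i, hi, hxi⟩ := Set.mem_iUnion₂.mp (ht (Set.mem_univ x))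
    have hyi : y ∈ V i := by
      have := congrFun h ⟨i, hi⟩
      exact this.mp hxi
    have h1 := Metric.mem_ball.mp (hVb i hxi)
    have h2 := Metric.mem_ball.mp (hVb i hyi)
    have h3 := dist_triangle_right x y i
    linarith
  obtain ⟨m, ⟨e⟩⟩ := Finite.exists_equiv_fin (b '' A)
  let g : (t → Prop) → ℕ := fun v => if h : v ∈ b '' A then e ⟨v, h⟩ else 0
  have hg : ∀ x (hx : x ∈ A), g (b x) = e ⟨b x, x, hx, rfl⟩ := fun x hx =>
    dif_pos (⟨x, hx, rfl⟩ : b x ∈ b '' A)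
  refine ⟨m, g ∘ b, hb.comp g, ?_, ?_⟩
  · ext k
    constructor
    · rintro ⟨x, hx, rfl⟩
      simp only [Function.comp_apply, hg x hx]
      exact (e _).2
    · intro hk
      obtain ⟨⟨_, x, hx, rfl⟩, hv⟩ := e.surjective ⟨k, hk⟩
      exact ⟨x, hx, by simp only [Function.comp_apply, hg x hx, hv]⟩
  · intro x hx y hy hxy
    simp only [Function.comp_apply, hg x hx, hg y hy] at hxy
    exact hbd x y (congrArg Subtype.val (e.injective (Fin.ext hxy)))

/-- By perfectness the class of colour `0` in `A` contains two distinct points. A clopen piece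
containing just one of them receives the new colour `m`. -/
theorem exists_coloring_succ [PerfectSpace X] {A : Set X} (hA : IsClopen A) (hne : A.Nonempty)
    {ε : ℝ} {m : ℕ} {a : X → ℕ} (ha : IsLocallyConstant a) (ham : a '' A = Set.Iio m)
    (had : ∀ x ∈ A, ∀ y ∈ A, a x = a y → dist x y < ε) :
    ∃ a' : X → ℕ, IsLocallyConstant a' ∧ a' '' A = Set.Iio (m + 1) ∧
      ∀ x ∈ A, ∀ y ∈ A, a' x = a' y → dist x y < ε := by
  classical
  have hlt : ∀ z ∈ A, a z < m := fun z hz => ham.subset ⟨z, hz, rfl⟩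
  have hm : 0 < m := by
    obtain ⟨z, hz⟩ := hne
    exact (Nat.zero_le _).trans_lt (hlt z hz)
  obtain ⟨x, hxA, hx0⟩ := ham.superset hm
  have hW : IsClopen (A ∩ a ⁻¹' {0}) := hA.inter (ha.isClopen_fiber 0)
  obtain ⟨y, hy, hyx⟩ := preperfect_iff_nhds.mp hW.isOpen.preperfect x ⟨hxA, hx0⟩ _
    (hW.isOpen.mem_nhds ⟨hxA, hx0⟩)
  obtain ⟨V, hV, hxV, hVy⟩ := exists_isClopen_mem_subset (isOpen_compl_singleton (x := y))
    (Set.mem_compl_singleton_iff.mpr hyx.symm)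
  have hyV : y ∉ V := fun h => hVy h rfl
  set W := V ∩ (A ∩ a ⁻¹' {0}) with hWdef
  have hWc : IsClopen W := hV.inter hW
  refine ⟨fun z => if z ∈ W then m else a z, ?_, ?_, ?_⟩
  · rw [IsLocallyConstant.iff_eventually_eq]
    intro z
    by_cases hz : z ∈ W
    · filter_upwards [hWc.isOpen.mem_nhds hz] with w hw
      simp [hz, hw]
    · filter_upwards [hWc.compl.isOpen.mem_nhds hz, ha.eventually_eq z] with w hw hw'
      have hw2 : w ∉ W := hw
      simp [hz, hw2, hw']
  · ext k
    constructor
    · rintro ⟨z, hz, rfl⟩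
      have := hlt z hz
      simp only [Set.mem_Iio]
      split_ifs <;> omega
    · intro hk
      by_cases hkm : k = m
      · exact ⟨x, hxA, by simp [hWdef, hxV, hxA, hx0, hkm]⟩
      by_cases hk0 : k = 0
      · exact ⟨y, hy.2.1, by simp [hWdef, hyV, hk0]; exact hy.2.2⟩
      · have : k < m := by
          have : k < m + 1 := hk
          omega
        obtain ⟨z, hz, hzk⟩ := ham.superset this
        exact ⟨z, hz, by simp [hWdef, hzk, hk0]⟩
  · intro z hz w hw hzw
    apply had z hz w hw
    have h1 := hlt z hz
    have h2 := hlt w hw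
    by_cases hzW : z ∈ W <;> by_cases hwW : w ∈ W
    · rw [hzW.2.2, hwW.2.2]
    all_goals
      simp only [hzW, hwW, if_true, if_false] at hzw
      omega

/-- Every sufficiently large number of colours can be attained, so two spaces can be given equally
many. -/
theorem exists_coloring [PerfectSpace X] {A : Set X} (hA : IsClopen A) (hne : A.Nonempty)
    {ε : ℝ} (hε : 0 < ε) : ∃ N, ∀ m ≥ N, ∃ a : X → ℕ, IsLocallyConstant a ∧
      a '' A = Set.Iio m ∧ ∀ x ∈ A, ∀ y ∈ A, a x = a y → dist x y < ε := by
  obtain ⟨N, a, h1, h2, h3⟩ := exists_coloring_fine A hε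
  refine ⟨N, fun m hm => ?_⟩
  induction m, hm using Nat.le_induction with
  | base => exact ⟨a, h1, h2, h3⟩
  | succ m _ ih =>
    obtain ⟨a, h1, h2, h3⟩ := ih
    exact exists_coloring_succ hA hne h1 h2 h3

/-- Refine each pair of fibres of equal colour with a common number of subcolours, and encode
(colour, subcolour) by `Nat.pair`. -/
theorem exists_common_refinement [PerfectSpace X] [PerfectSpace Y] {a : X → ℕ} {b : Y → ℕ}
    (ha : IsLocallyConstant a) (hb : IsLocallyConstant b) (hab : Set.range a = Set.range b)
    {ε : ℝ} (hε : 0 < ε) :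
    ∃ (a' : X → ℕ) (b' : Y → ℕ), (IsLocallyConstant a' ∧ IsLocallyConstant b' ∧
      Set.range a' = Set.range b') ∧ (∃ q : ℕ → ℕ, q ∘ a' = a ∧ q ∘ b' = b) ∧
      (∀ x y, a' x = a' y → dist x y < ε) ∧ ∀ x y, b' x = b' y → dist x y < ε := by
  have h : ∀ i, ∃ (u : X → ℕ) (v : Y → ℕ), IsLocallyConstant u ∧ IsLocallyConstant v ∧
      u '' (a ⁻¹' {i}) = v '' (b ⁻¹' {i}) ∧
      (∀ x ∈ a ⁻¹' {i}, ∀ y ∈ a ⁻¹' {i}, u x = u y → dist x y < ε) ∧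
      ∀ x ∈ b ⁻¹' {i}, ∀ y ∈ b ⁻¹' {i}, v x = v y → dist x y < ε := by
    intro i
    by_cases hi : i ∈ Set.range a
    · obtain ⟨N, hN⟩ := exists_coloring (ha.isClopen_fiber i) (by simpa [Set.Nonempty] using hi) hε
      obtain ⟨N', hN'⟩ := exists_coloring (hb.isClopen_fiber i)
        (by rw [hab] at hi; simpa [Set.Nonempty] using hi) hε
      obtain ⟨u, h1, h2, h3⟩ := hN (max N N') (le_max_left _ _)
      obtain ⟨v, h4, h5, h6⟩ := hN' (max N N') (le_max_right _ _)
      exact ⟨u, v, h1, h4, h2.trans h5.symm, h3, h6⟩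
    · have h1 : a ⁻¹' {i} = ∅ := Set.preimage_singleton_eq_empty.mpr hi
      have h2 : b ⁻¹' {i} = ∅ := Set.preimage_singleton_eq_empty.mpr (hab ▸ hi)
      exact ⟨fun _ => 0, fun _ => 0, .const 0, .const 0, by simp [h1, h2], by simp [h1],
        by simp [h2]⟩
  choose u v hu hv huv hud hvd using h
  refine ⟨fun x => Nat.pair (a x) (u (a x) x), fun y => Nat.pair (b y) (v (b y) y),
    ⟨?_, ?_, ?_⟩, ⟨fun n => n.unpair.1, ?_, ?_⟩, ?_, ?_⟩
  · rw [IsLocallyConstant.iff_eventually_eq]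
    intro x
    filter_upwards [ha.eventually_eq x, (hu (a x)).eventually_eq x] with y h1 h2
    rw [h1, h2]
  · rw [IsLocallyConstant.iff_eventually_eq]
    intro x
    filter_upwards [hb.eventually_eq x, (hv (b x)).eventually_eq x] with y h1 h2
    rw [h1, h2]
  · apply Set.Subset.antisymm
    · rintro _ ⟨x, rfl⟩
      obtain ⟨y, hy, hxy⟩ := (huv (a x)).subset ⟨x, rfl, rfl⟩
      have hy : b y = a x := hy
      exact ⟨y, by simp only [hy, hxy]⟩
    · rintro _ ⟨y, rfl⟩
      obtain ⟨x, hx, hxy⟩ := (huv (b y)).superset ⟨y, rfl, rfl⟩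
      have hx : a x = b y := hx
      exact ⟨x, by simp only [hx, hxy]⟩
  · ext x; simp
  · ext y; simp
  · intro x y hxy
    obtain ⟨h1, h2⟩ := Nat.pair_eq_pair.mp hxy
    exact hud (a x) x rfl y h1.symm (by rw [h2, h1])
  · intro x y hxy
    obtain ⟨h1, h2⟩ := Nat.pair_eq_pair.mp hxy
    exact hvd (b x) x rfl y h1.symm (by rw [h2, h1])

/-- The colour classes prescribed by `x` form a decreasing sequence of nonempty compact sets with
diameters tending to `0`. Stage `0` is an arbitrary given colouring, so diameters are controlled
only from stage `1` on. -/
theorem exists_unique_of_colorings {X Y : Type*} [MetricSpace Y] [CompactSpace Y]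
    {a : ℕ → X → ℕ} {b : ℕ → Y → ℕ}
    (hb : ∀ n, IsLocallyConstant (b n)) (hab : ∀ n, Set.range (a n) = Set.range (b n))
    (hq : ∀ n, ∃ q : ℕ → ℕ, q ∘ a (n + 1) = a n ∧ q ∘ b (n + 1) = b n)
    (hbd : ∀ (n : ℕ) (x y : Y), b (n + 1) x = b (n + 1) y → dist x y < 1 / ((n : ℝ) + 1)) (x : X) :
    ∃! y, ∀ n, b n y = a n x := by
  have hcl : ∀ n, IsClosed {y | b n y = a n x} := fun n => (hb n).isClosed_fiber (a n x)
  have h := IsCompact.nonempty_iInter_of_sequence_nonempty_isCompact_isClosed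
    (fun n => {y | b n y = a n x}) (fun n y hy => ?_) (fun n => ?_) (hcl 0).isCompact hcl
  · obtain ⟨y, hy⟩ := h
    have hy : ∀ n, b n y = a n x := fun n => Set.mem_iInter.mp hy n
    refine ⟨y, hy, fun z hz => ?_⟩
    refine eq_of_forall_dist_le fun ε hε => ?_
    obtain ⟨n, hn⟩ := exists_nat_one_div_lt hε
    exact ((hbd n z y ((hz _).trans (hy _).symm)).trans hn).le
  · obtain ⟨q, h1, h2⟩ := hq n
    have hy : b (n + 1) y = a (n + 1) x := hy
    change b n y = a n x
    rw [← h1, ← h2, Function.comp_apply, Function.comp_apply, hy]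
  · obtain ⟨y, hy⟩ := (hab n).subset ⟨x, rfl⟩
    exact ⟨y, hy⟩

/-- Brouwer's theorem: two Cantor spaces are homeomorphic, by a homeomorphism matching two given
finite clopen partitions. -/
theorem exists_homeomorph_of_coloring [PerfectSpace X] [PerfectSpace Y] {a : X → ℕ} {b : Y → ℕ}
    (ha : IsLocallyConstant a) (hb : IsLocallyConstant b) (hab : Set.range a = Set.range b) :
    ∃ f : X ≃ₜ Y, ∀ x, b (f x) = a x := by
  let P : (X → ℕ) × (Y → ℕ) → Prop := fun p =>
    IsLocallyConstant p.1 ∧ IsLocallyConstant p.2 ∧ Set.range p.1 = Set.range p.2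
  have step : ∀ (p : {p // P p}) (n : ℕ), ∃ p' : {p // P p},
      (∃ q : ℕ → ℕ, q ∘ p'.1.1 = p.1.1 ∧ q ∘ p'.1.2 = p.1.2) ∧
      (∀ x y, p'.1.1 x = p'.1.1 y → dist x y < 1 / ((n : ℝ) + 1)) ∧
      ∀ x y, p'.1.2 x = p'.1.2 y → dist x y < 1 / ((n : ℝ) + 1) := by
    rintro ⟨⟨u, v⟩, h1, h2, h3⟩ n
    obtain ⟨u', v', h, hq, hd, hd'⟩ := exists_common_refinement h1 h2 h3
      (ε := 1 / ((n : ℝ) + 1)) (by positivity)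
    exact ⟨⟨(u', v'), h⟩, hq, hd, hd'⟩
  choose next hq hd hd' using step
  -- The recursion starts at `(a, b)`, so that stage `0` of the limit map is the required
  -- compatibility.
  let s : ℕ → {p // P p} := fun n =>
    Nat.rec (motive := fun _ => {p // P p}) ⟨(a, b), ha, hb, hab⟩ (fun n p => next p n) n
  let u : ℕ → X → ℕ := fun n => (s n).1.1
  let v : ℕ → Y → ℕ := fun n => (s n).1.2
  have hu : ∀ n, IsLocallyConstant (u n) := fun n => (s n).2.1
  have hv : ∀ n, IsLocallyConstant (v n) := fun n => (s n).2.2.1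
  have huv : ∀ n, Set.range (u n) = Set.range (v n) := fun n => (s n).2.2.2
  have hq1 : ∀ n, ∃ q : ℕ → ℕ, q ∘ u (n + 1) = u n ∧ q ∘ v (n + 1) = v n := fun n => hq (s n) n
  have hud : ∀ (n : ℕ) (x y : X), u (n + 1) x = u (n + 1) y → dist x y < 1 / ((n : ℝ) + 1) :=
    fun n => hd (s n) n
  have hvd : ∀ (n : ℕ) (x y : Y), v (n + 1) x = v (n + 1) y → dist x y < 1 / ((n : ℝ) + 1) :=
    fun n => hd' (s n) n
  choose f hf _ using exists_unique_of_colorings hv huv hq1 hvd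
  have hf : ∀ x n, v n (f x) = u n x := hf
  have hun : ∀ y : Y, ∃! x, ∀ n, u n x = v n y :=
    exists_unique_of_colorings hu (fun n => (huv n).symm)
      (fun n => (hq1 n).imp fun q h => ⟨h.2, h.1⟩) hud
  have hf_cont : Continuous f := by
    rw [Metric.continuous_iff']
    intro x ε hε
    obtain ⟨n, hn⟩ := exists_nat_one_div_lt hε
    filter_upwards [(hu (n + 1)).eventually_eq x] with y hy
    exact (hvd n _ _ ((hf y (n + 1)).trans (hy.trans (hf x (n + 1)).symm))).trans hn
  have hbij : Function.Bijective f := by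
    constructor
    · intro x y hxy
      exact (hun (f x)).unique (fun n => (hf x n).symm) fun n => by
        rw [hxy]
        exact (hf y n).symm
    · intro y
      obtain ⟨x, hx, -⟩ := hun y
      exact ⟨x, (exists_unique_of_colorings hv huv hq1 hvd x).unique (hf x) fun n => (hx n).symm⟩
  exact ⟨Continuous.homeoOfEquivCompactToT2 (f := Equiv.ofBijective f hbij) hf_cont,
    fun x => hf x 0⟩

theorem perfectSpace_of_isOpen {Z : Type*} [TopologicalSpace Z] [PerfectSpace Z] {A : Set Z}
    (hA : IsOpen A) : PerfectSpace A := by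
  refine ⟨preperfect_iff_nhds.mpr fun x _ U hU => ?_⟩
  obtain ⟨V, hV, hVU⟩ := mem_nhds_subtype A x U |>.mp hU
  obtain ⟨y, hy, hyx⟩ := preperfect_iff_nhds.mp hA.preperfect x x.2 V hV
  exact ⟨⟨y, hy.2⟩, ⟨hVU hy.1, trivial⟩, fun h => hyx (congrArg Subtype.val h)⟩

end CantorHomeo

/-! ### Periodic spectrum and phases -/

section Spectrum

/-- A locally constant `φ : Z → ℤ/p` with `φ ∘ α = φ + 1`. -/
def HasPhase {Z : Type*} [TopologicalSpace Z] (α : Z ≃ₜ Z) (p : ℕ) : Prop :=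
  ∃ φ : Z → ZMod p, IsLocallyConstant φ ∧ ∀ z, φ (α z) = φ z + 1

theorem homeo_pow_succ_apply {Z : Type*} [TopologicalSpace Z] (α : Z ≃ₜ Z) (n : ℕ) (z : Z) :
    (α ^ (n + 1)) z = α ((α ^ n) z) := by
  rw [pow_succ']
  rfl

/-- The phase of `z` is the index of the piece containing it; conversely, take `U` to be the zero
fibre of the phase. -/
theorem mem_periodicSpectrum_iff {Z : Type*} [TopologicalSpace Z] {α : Z ≃ₜ Z} {p : ℕ} :
    p ∈ periodicSpectrum α ↔ 0 < p ∧ HasPhase α p := by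
  constructor
  · rintro ⟨hp, U, hU, hcov, hdisj⟩
    refine ⟨hp, ?_⟩
    have hex : ∀ z, ∃ i < p, z ∈ (α ^ i) '' U := fun z => by
      obtain ⟨i, hi, hz⟩ := Set.mem_iUnion₂.mp (hcov.superset (Set.mem_univ z))
      exact ⟨i, Finset.mem_range.mp hi, hz⟩
    choose ι hι hιU using hex
    have huniq : ∀ z, ∀ j < p, z ∈ (α ^ j) '' U → ι z = j := fun z j hj hz => by
      by_contra hne
      exact Set.disjoint_left.mp (hdisj _ (hι z) j hj hne) (hιU z) hz
    have hloc : IsLocallyConstant ι := by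
      rw [IsLocallyConstant.iff_eventually_eq]
      intro z
      filter_upwards [((α ^ ι z).isOpenMap U hU.isOpen).mem_nhds (hιU z)] with w hw
      exact huniq w _ (hι z) hw
    refine ⟨fun z => (ι z : ZMod p), hloc.comp _, fun z => ?_⟩
    obtain ⟨u, hu, huz⟩ := hιU z
    have hnext : ι z + 1 < p → ι (α z) = ι z + 1 := fun h =>
      huniq _ _ h ⟨u, hu, by rw [homeo_pow_succ_apply, huz]⟩
    by_cases h : ι z + 1 < p
    · simp [hnext h]
    · have hlast : ι z + 1 = p := le_antisymm (hι z) (not_lt.mp h)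
      -- If `α z` lay in piece `j + 1`, then `z` would lie in piece `j < p - 1`, whereas it lies in
      -- the last one.
      have hzero : ι (α z) = 0 := by
        obtain ⟨v, hv, hvz⟩ := hιU (α z)
        have h1 := hι (α z)
        revert hvz h1
        cases ι (α z) with
        | zero => exact fun _ _ => rfl
        | succ j =>
          intro hvz h1
          rw [homeo_pow_succ_apply] at hvz
          have := huniq z j (by omega) ⟨v, hv, α.injective hvz⟩
          omega
      have h2 := congrArg (Nat.cast (R := ZMod p)) hlast
      simp only [Nat.cast_add, Nat.cast_one, CharP.cast_eq_zero] at h2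
      simp [hzero, h2]
  · rintro ⟨hp, φ, hφ, hstep⟩
    have : NeZero p := ⟨hp.ne'⟩
    have hpow : ∀ (n : ℕ) z, φ ((α ^ n) z) = φ z + n := by
      intro n z
      induction n with
      | zero => simp
      | succ n ih => rw [homeo_pow_succ_apply, hstep, ih]; push_cast; ring
    have himg : ∀ n : ℕ, (α ^ n) '' (φ ⁻¹' {0}) = φ ⁻¹' {(n : ZMod p)} := by
      intro n
      ext z
      constructor
      · rintro ⟨w, hw, rfl⟩
        have hw : φ w = 0 := hw
        simp [hpow, hw]
      · intro hz
        obtain ⟨w, rfl⟩ := (α ^ n).surjective z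
        refine ⟨w, ?_, rfl⟩
        simpa [hpow] using hz
    refine ⟨hp, φ ⁻¹' {0}, hφ.isClopen_fiber 0, ?_, ?_⟩
    · refine Set.eq_univ_of_forall fun z => Set.mem_iUnion₂.mpr ⟨(φ z).val, ?_, ?_⟩
      · exact Finset.mem_range.mpr (ZMod.val_lt _)
      · rw [himg]
        simp
    · intro i hi j hj hij
      rw [himg, himg]
      refine Set.disjoint_left.mpr fun z hz hz' => hij ?_
      have h1 : (i : ZMod p) = j := by
        rw [← Set.mem_singleton_iff.mp hz, ← Set.mem_singleton_iff.mp hz']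
      rw [ZMod.natCast_eq_natCast_iff] at h1
      exact Nat.ModEq.eq_of_lt_of_lt h1 hi hj

theorem exists_forall_dist_lt_eq {Z T : Type*} [MetricSpace Z] [CompactSpace Z] {φ : Z → T}
    (hφ : IsLocallyConstant φ) : ∃ δ > 0, ∀ x y, dist x y < δ → φ x = φ y := by
  obtain ⟨δ, hδ, h⟩ := lebesgue_number_lemma_of_metric (s := Set.univ) (c := fun t => φ ⁻¹' {t})
    isCompact_univ (fun t => hφ.isOpen_fiber t) fun z _ => Set.mem_iUnion.mpr ⟨φ z, rfl⟩
  refine ⟨δ, hδ, fun x y hxy => ?_⟩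
  obtain ⟨t, ht⟩ := h x trivial
  have h1 : φ x = t := ht (Metric.mem_ball_self hδ)
  have h2 : φ y = t := ht (by rwa [Metric.mem_ball, dist_comm])
  rw [h1, h2]

/-- Let `φ` be a phase for `β`. Once `σ n * α * (σ n)⁻¹` is closer to `β` than the scale on which
`φ` is constant, `φ ∘ σ n` is a phase for `α`. -/
theorem UnilatApproxConjVia.periodicSpectrum_subset {Z : Type*} [MetricSpace Z] [CompactSpace Z]
    {α β : Z ≃ₜ Z} {σ : ℕ → (Z ≃ₜ Z)} (h : UnilatApproxConjVia α β σ) :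
    periodicSpectrum β ⊆ periodicSpectrum α := by
  intro p hp
  rw [mem_periodicSpectrum_iff] at hp ⊢
  obtain ⟨hp, φ, hφ, hstep⟩ := hp
  refine ⟨hp, ?_⟩
  obtain ⟨δ, hδ, hφδ⟩ := exists_forall_dist_lt_eq hφ
  obtain ⟨n, hn⟩ := (h.eventually_lt_const hδ).exists
  refine ⟨φ ∘ σ n, hφ.comp_continuous (σ n).continuous, fun z => ?_⟩
  have h1 := hφδ _ _ ((dist_le_homeo_dist _ _ (σ n z)).trans_lt hn)
  have h2 : (σ n * α * (σ n)⁻¹) (σ n z) = σ n (α z) := by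
    change σ n (α ((σ n).symm (σ n z))) = _
    rw [(σ n).symm_apply_apply]
  rw [h2, hstep] at h1
  exact h1

theorem WeakApproxConj.periodicSpectrum_eq {Z : Type*} [MetricSpace Z] [CompactSpace Z]
    {α β : Z ≃ₜ Z} (h : WeakApproxConj α β) : periodicSpectrum α = periodicSpectrum β := by
  obtain ⟨σ, γ, h1, h2⟩ := h
  exact h2.periodicSpectrum_subset.antisymm h1.periodicSpectrum_subset

theorem periodicSpectrum_skewProduct {K Ω : Type*} [MetricSpace K] [MetricSpace Ω]
    [CompactSpace Ω] [ConnectedSpace Ω] (s : K ≃ₜ K) (c : C(K, Ω ≃ₜ Ω)) :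
    periodicSpectrum (skewProduct s c) = periodicSpectrum s := by
  ext p
  rw [mem_periodicSpectrum_iff, mem_periodicSpectrum_iff]
  refine and_congr_right fun _ => ⟨?_, ?_⟩
  · rintro ⟨φ, hφ, hstep⟩
    -- Connectedness of `Ω` enters here: the phase is constant on fibres.
    have hconst : ∀ x ω ω', φ (x, ω) = φ (x, ω') := fun x ω ω' =>
      (hφ.comp_continuous (g := φ) (Continuous.prodMk_right x)).apply_eq_of_preconnectedSpace ω ω'
    obtain ⟨ω₀⟩ : Nonempty Ω := inferInstance
    refine ⟨fun x => φ (x, ω₀), hφ.comp_continuous (Continuous.prodMk_left ω₀), fun x => ?_⟩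
    rw [← hstep (x, ω₀), skewProduct_apply]
    exact hconst _ _ _
  · rintro ⟨φ, hφ, hstep⟩
    exact ⟨φ ∘ Prod.fst, hφ.comp_continuous continuous_fst, fun z => hstep z.1⟩

end Spectrum

/-! ### Hitting times of clopen sets -/

section Hitting

variable {Z : Type*}

/-- The first time `k ≥ 0` at which the forward `g`-orbit of `z` is in `D`. -/
def hit (g : Z → Z) (D : Set Z) (z : Z) : ℕ := sInf {k | g^[k] z ∈ D}

theorem iterate_hit_mem {g : Z → Z} {D : Set Z} {z : Z} (h : ∃ k, g^[k] z ∈ D) :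
    g^[hit g D z] z ∈ D := Nat.sInf_mem (s := {k | g^[k] z ∈ D}) h

theorem notMem_of_lt_hit {g : Z → Z} {D : Set Z} {z : Z} {k : ℕ} (h : k < hit g D z) :
    g^[k] z ∉ D := Nat.notMem_of_lt_sInf (s := {k | g^[k] z ∈ D}) h

theorem hit_eq {g : Z → Z} {D : Set Z} {z : Z} {k : ℕ} (hk : g^[k] z ∈ D)
    (hlt : ∀ j < k, g^[j] z ∉ D) : hit g D z = k := by
  refine le_antisymm (Nat.sInf_le hk) ?_
  by_contra! h
  exact hlt _ h (iterate_hit_mem ⟨k, hk⟩)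

theorem hit_of_mem {g : Z → Z} {D : Set Z} {z : Z} (hz : z ∈ D) : hit g D z = 0 :=
  hit_eq hz fun _ h => absurd h (Nat.not_lt_zero _)

theorem hit_of_notMem {g : Z → Z} {D : Set Z} {z : Z} (hz : z ∉ D) (h : ∃ k, g^[k] (g z) ∈ D) :
    hit g D z = hit g D (g z) + 1 := by
  refine hit_eq (by simpa only [Function.iterate_succ_apply] using iterate_hit_mem h) ?_
  rintro (_ | j) hj
  · exact hz
  · rw [Function.iterate_succ_apply]
    exact notMem_of_lt_hit (by omega)

theorem isLocallyConstant_hit [TopologicalSpace Z] {g : Z → Z} (hg : Continuous g) {D : Set Z}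
    (hD : IsClopen D) (h : ∀ z, ∃ k, g^[k] z ∈ D) : IsLocallyConstant (hit g D) := by
  rw [IsLocallyConstant.iff_eventually_eq]
  intro z
  have h1 : ∀ᶠ w in 𝓝 z, g^[hit g D z] w ∈ D :=
    (hg.iterate _).continuousAt (hD.isOpen.mem_nhds (iterate_hit_mem (h z)))
  have h2 : ∀ᶠ w in 𝓝 z, ∀ j ∈ Finset.range (hit g D z), g^[j] w ∈ Dᶜ := by
    rw [Filter.eventually_all_finset]
    intro j hj
    exact (hg.iterate _).continuousAt
      (hD.compl.isOpen.mem_nhds (notMem_of_lt_hit (Finset.mem_range.mp hj)))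
  filter_upwards [h1, h2] with w hw hw'
  exact hit_eq hw fun j hj => hw' j (Finset.mem_range.mpr hj)

end Hitting

/-! ### Kakutani–Rokhlin towers over a section -/

section Towers

variable {Z : Type*} [TopologicalSpace Z]

/-- A clopen set which every forward and every backward orbit meets. -/
structure IsSection (α : Z ≃ₜ Z) (D : Set Z) : Prop where
  isClopen : IsClopen D
  forward : ∀ z, ∃ k, α^[k] z ∈ D
  backward : ∀ z, ∃ k, α.symm^[k] z ∈ D

/-- The time since the last visit to `D`. -/
def backTime (α : Z ≃ₜ Z) (D : Set Z) (z : Z) : ℕ := hit α.symm D z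

/-- The time, at least `1`, until the next visit to `D`. -/
def returnTime (α : Z ≃ₜ Z) (D : Set Z) (z : Z) : ℕ := hit α D (α z) + 1

/-- The place of the last visit to `D`. -/
def lastVisit (α : Z ≃ₜ Z) (D : Set Z) (z : Z) : Z := α.symm^[backTime α D z] z

variable {α : Z ≃ₜ Z} {D : Set Z} {z : Z}

theorem symm_iterate_iterate (α : Z ≃ₜ Z) (k : ℕ) (z : Z) : α.symm^[k] (α^[k] z) = z :=
  Function.LeftInverse.iterate α.symm_apply_apply k z

theorem iterate_symm_iterate (α : Z ≃ₜ Z) (k : ℕ) (z : Z) : α^[k] (α.symm^[k] z) = z :=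
  Function.LeftInverse.iterate (g := α) α.apply_symm_apply k z

theorem returnTime_pos : 0 < returnTime α D z := Nat.succ_pos _

theorem IsSection.isLocallyConstant_backTime (h : IsSection α D) :
    IsLocallyConstant (backTime α D) :=
  isLocallyConstant_hit α.symm.continuous h.isClopen h.backward

theorem IsSection.isLocallyConstant_returnTime (h : IsSection α D) :
    IsLocallyConstant (returnTime α D) :=
  ((isLocallyConstant_hit α.continuous h.isClopen h.forward).comp_continuous α.continuous).comp
    Nat.succ

theorem IsSection.lastVisit_mem (h : IsSection α D) (z : Z) : lastVisit α D z ∈ D :=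
  iterate_hit_mem (h.backward z)

theorem iterate_lastVisit (z : Z) : α^[backTime α D z] (lastVisit α D z) = z :=
  iterate_symm_iterate α _ z

theorem backTime_of_mem (hz : z ∈ D) : backTime α D z = 0 := hit_of_mem hz

theorem IsSection.backTime_apply (h : IsSection α D) (hz : α z ∉ D) :
    backTime α D (α z) = backTime α D z + 1 := by
  rw [backTime, hit_of_notMem hz (h.backward _), α.symm_apply_apply]
  rfl

theorem returnTime_of_apply_mem (hz : α z ∈ D) : returnTime α D z = 1 := by
  rw [returnTime, hit_of_mem hz]

theorem IsSection.returnTime_of_apply_notMem (h : IsSection α D) (hz : α z ∉ D) :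
    returnTime α D z = returnTime α D (α z) + 1 := by
  rw [returnTime, hit_of_notMem hz (h.forward _)]
  rfl

theorem IsSection.iterate_returnTime_mem (h : IsSection α D) (z : Z) :
    α^[returnTime α D z] z ∈ D := by
  rw [returnTime, Function.iterate_succ_apply]
  exact iterate_hit_mem (h.forward _)

theorem iterate_notMem_of_lt_returnTime {j : ℕ} (hj : 0 < j) (hlt : j < returnTime α D z) :
    α^[j] z ∉ D := by
  obtain ⟨j, rfl⟩ := Nat.exists_eq_succ_of_ne_zero hj.ne'
  rw [Function.iterate_succ_apply]
  exact notMem_of_lt_hit (Nat.succ_lt_succ_iff.mp hlt)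

theorem returnTime_eq {s : ℕ} (hs : 0 < s) (hmem : α^[s] z ∈ D)
    (hnot : ∀ j, 0 < j → j < s → α^[j] z ∉ D) : returnTime α D z = s := by
  obtain ⟨s, rfl⟩ := Nat.exists_eq_succ_of_ne_zero hs.ne'
  rw [returnTime, hit_eq (k := s)]
  · simpa only [Function.iterate_succ_apply] using hmem
  · intro j hj
    simpa only [Function.iterate_succ_apply] using hnot (j + 1) j.succ_pos (Nat.succ_lt_succ hj)

theorem IsSection.iterate_of_lt_returnTime (h : IsSection α D) (z : Z) {k : ℕ}
    (hk : k < returnTime α D z) : backTime α D (α^[k] z) = backTime α D z + k ∧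
      returnTime α D (α^[k] z) + k = returnTime α D z := by
  induction k with
  | zero => simp
  | succ k ih =>
    obtain ⟨h1, h2⟩ := ih (by omega)
    have h3 := iterate_notMem_of_lt_returnTime (Nat.succ_pos k) hk
    rw [Function.iterate_succ_apply'] at h3 ⊢
    rw [h.returnTime_of_apply_notMem h3] at h2
    exact ⟨by rw [h.backTime_apply h3, h1, add_assoc], by omega⟩

/-- The sum is the height of the tower through `z`. Each step up raises the first term by one and
lowers the second by one, so the sum agrees with its value at the base. -/
theorem IsSection.backTime_add_returnTime (h : IsSection α D) (z : Z) :
    backTime α D z + returnTime α D z = returnTime α D (lastVisit α D z) := by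
  induction hn : backTime α D z generalizing z with
  | zero => simp [lastVisit, hn]
  | succ n ih =>
    obtain ⟨w, rfl⟩ := α.surjective z
    have hw : α w ∉ D := fun hw => by simp [backTime_of_mem hw] at hn
    have h1 := h.backTime_apply hw
    have h2 : backTime α D w = n := by omega
    have h3 : lastVisit α D (α w) = lastVisit α D w := by
      rw [lastVisit, h1, Function.iterate_succ_apply, α.symm_apply_apply]
      rfl
    rw [h3, ← ih w h2, h.returnTime_of_apply_notMem hw]
    omega

theorem IsSection.backTime_lt (h : IsSection α D) (z : Z) :
    backTime α D z < returnTime α D (lastVisit α D z) := by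
  have := h.backTime_add_returnTime z
  have := returnTime_pos (α := α) (D := D) (z := z)
  omega

end Towers

/-! ### Identifying towers of equal heights -/

section TowerMap

variable {Z : Type*} [TopologicalSpace Z] {α β : Z ≃ₜ Z} {D B : Set Z}

/-- The map from the towers of `α` over `D` to the towers of `β` which is `F` on the bases. -/
def towerMap (α β : Z ≃ₜ Z) (D : Set Z) (F : Z → Z) (z : Z) : Z :=
  β^[backTime α D z] (F (lastVisit α D z))

theorem continuous_towerMap (hD : IsSection α D) {F : Z → Z} (hF : ContinuousOn F D) :
    Continuous (towerMap α β D F) := by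
  rw [continuous_iff_continuousAt]
  intro z
  have h1 : towerMap α β D F =ᶠ[𝓝 z]
      fun w => β^[backTime α D z] (F (α.symm^[backTime α D z] w)) := by
    filter_upwards [hD.isLocallyConstant_backTime.eventually_eq z] with w hw
    rw [towerMap, lastVisit, hw]
  refine ContinuousAt.congr ?_ h1.symm
  have h2 : ContinuousAt F (α.symm^[backTime α D z] z) :=
    hF.continuousAt (hD.isClopen.isOpen.mem_nhds (hD.lastVisit_mem z))
  exact (β.continuous.iterate _).continuousAt.comp
    (ContinuousAt.comp (f := α.symm^[backTime α D z]) h2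
      (α.symm.continuous.iterate _).continuousAt)

variable {F G : Z → Z}

/-- Equality of return times keeps the climb from `F (lastVisit α D z)` within a single tower of
`β`, so level and base point can be read off from the image. -/
theorem backTime_towerMap (hD : IsSection α D) (hB : IsSection β B) (hF : Set.MapsTo F D B)
    (hr : ∀ d ∈ D, returnTime β B (F d) = returnTime α D d) (z : Z) :
    backTime β B (towerMap α β D F z) = backTime α D z ∧
      lastVisit β B (towerMap α β D F z) = F (lastVisit α D z) := by
  have hm := hD.lastVisit_mem z
  have h1 := hD.backTime_lt z
  rw [← hr _ hm] at h1
  have h2 := (hB.iterate_of_lt_returnTime _ h1).1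
  rw [backTime_of_mem (hF hm), zero_add] at h2
  refine ⟨h2, ?_⟩
  rw [lastVisit, towerMap, h2, symm_iterate_iterate]

theorem towerMap_towerMap (hD : IsSection α D) (hB : IsSection β B) (hF : Set.MapsTo F D B)
    (hr : ∀ d ∈ D, returnTime β B (F d) = returnTime α D d) (hGF : ∀ d ∈ D, G (F d) = d) (z : Z) :
    towerMap β α B G (towerMap α β D F z) = z := by
  obtain ⟨h1, h2⟩ := backTime_towerMap hD hB hF hr z
  rw [towerMap, h1, h2, hGF _ (hD.lastVisit_mem z)]
  exact iterate_lastVisit z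

/-- Below the top of a tower the map intertwines exactly. From the top, `α` returns to `D` and `β`
returns to `B`, generally at different points, so only membership in `B` remains. -/
theorem towerMap_apply (hD : IsSection α D) (hB : IsSection β B) (hF : Set.MapsTo F D B)
    (hr : ∀ d ∈ D, returnTime β B (F d) = returnTime α D d) (z : Z) :
    towerMap α β D F (α z) = β (towerMap α β D F z) ∨
      (towerMap α β D F (α z) ∈ B ∧ β (towerMap α β D F z) ∈ B) := by
  by_cases hz : α z ∈ D
  · right
    constructor
    · rw [towerMap, lastVisit, backTime_of_mem hz]
      exact hF hz
    · have hm := hD.lastVisit_mem z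
      have h1 := hD.backTime_add_returnTime z
      rw [returnTime_of_apply_mem hz, ← hr _ hm] at h1
      have h2 := hB.iterate_returnTime_mem (F (lastVisit α D z))
      rwa [← h1, Function.iterate_succ_apply'] at h2
  · left
    have h1 := hD.backTime_apply hz
    rw [towerMap, lastVisit, h1, Function.iterate_succ_apply', Function.iterate_succ_apply,
      α.symm_apply_apply]
    rfl

/-- If the towers over `D` and `B` have the same heights then they can be identified. -/
theorem exists_homeomorph_of_sections (hD : IsSection α D) (hB : IsSection β B) (f : D ≃ₜ B)
    (hr : ∀ d, returnTime β B (f d) = returnTime α D d) :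
    ∃ σ : Z ≃ₜ Z, ∀ z, σ (α z) = β (σ z) ∨ (σ (α z) ∈ B ∧ β (σ z) ∈ B) := by
  classical
  -- The values off `D` are irrelevant: `towerMap` evaluates `F` only at last visits to `D`.
  let F : Z → Z := fun z => if h : z ∈ D then f ⟨z, h⟩ else z
  let G : Z → Z := fun z => if h : z ∈ B then f.symm ⟨z, h⟩ else z
  have hF : ∀ z (h : z ∈ D), F z = f ⟨z, h⟩ := fun z h => dif_pos h
  have hG : ∀ z (h : z ∈ B), G z = f.symm ⟨z, h⟩ := fun z h => dif_pos h
  have hFm : Set.MapsTo F D B := fun z h => by rw [hF z h]; exact (f _).2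
  have hGm : Set.MapsTo G B D := fun z h => by rw [hG z h]; exact (f.symm _).2
  have hGF : ∀ d ∈ D, G (F d) = d := fun d h => by
    rw [hG _ (hFm h)]
    simp only [hF d h, Subtype.coe_eta, Homeomorph.symm_apply_apply]
  have hFG : ∀ d ∈ B, F (G d) = d := fun d h => by
    rw [hF _ (hGm h)]
    simp only [hG d h, Subtype.coe_eta, Homeomorph.apply_symm_apply]
  have hFr : ∀ d ∈ D, returnTime β B (F d) = returnTime α D d := fun d h => by
    rw [hF d h]
    exact hr ⟨d, h⟩
  have hGr : ∀ d ∈ B, returnTime α D (G d) = returnTime β B d := fun d h => by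
    rw [← hFr _ (hGm h), hFG d h]
  have hFc : ContinuousOn F D := by
    rw [continuousOn_iff_continuous_domRestrict]
    exact (continuous_subtype_val.comp f.continuous).congr fun d => (hF d d.2).symm
  have hGc : ContinuousOn G B := by
    rw [continuousOn_iff_continuous_domRestrict]
    exact (continuous_subtype_val.comp f.symm.continuous).congr fun d => (hG d d.2).symm
  exact ⟨{ toFun := towerMap α β D F
           invFun := towerMap β α B G
           left_inv := towerMap_towerMap hD hB hFm hFr hGF
           right_inv := towerMap_towerMap hB hD hGm hGr hFG
           continuous_toFun := continuous_towerMap hD hFc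
           continuous_invFun := continuous_towerMap hB hGc },
    towerMap_apply hD hB hFm hFr⟩

end TowerMap

/-! ### Minimal homeomorphisms: recurrence and aperiodicity -/

section Minimal

variable {Z : Type*} [TopologicalSpace Z] {α : Z ≃ₜ Z}

theorem homeo_pow_apply (α : Z ≃ₜ Z) (n : ℕ) (z : Z) : (α ^ n) z = α^[n] z := by
  induction n with
  | zero => rfl
  | succ n ih => rw [homeo_pow_succ_apply, ih, Function.iterate_succ_apply']

theorem IsMinimalHomeo.symm (h : IsMinimalHomeo α) : IsMinimalHomeo α.symm := by
  intro C hC hinv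
  refine h C hC ?_
  conv_lhs => rw [← hinv]
  rw [← Set.image_comp]
  simp

theorem IsMinimalHomeo.exists_iterate_mem [CompactSpace Z] (h : IsMinimalHomeo α) {O : Set Z}
    (hO : IsOpen O) (hne : O.Nonempty) (z : Z) : ∃ k, α^[k] z ∈ O := by
  set W : Set Z := ⋃ k : ℤ, (α ^ k : Z ≃ₜ Z) ⁻¹' O with hW
  have hopen : ∀ k : ℤ, IsOpen ((α ^ k : Z ≃ₜ Z) ⁻¹' O) := fun k =>
    hO.preimage (α ^ k : Z ≃ₜ Z).continuous
  have hadd : ∀ (k l : ℤ) (w : Z),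
      (α ^ (k + l) : Z ≃ₜ Z) w = (α ^ k : Z ≃ₜ Z) ((α ^ l : Z ≃ₜ Z) w) :=
    fun k l w => by
      rw [zpow_add]
      rfl
  have hWα : ∀ w, α w ∈ W ↔ w ∈ W := by
    intro w
    simp only [hW, Set.mem_iUnion, Set.mem_preimage]
    constructor
    · rintro ⟨k, hk⟩
      exact ⟨k + 1, by rwa [hadd, zpow_one]⟩
    · rintro ⟨k, hk⟩
      exact ⟨k - 1, by rwa [← sub_add_cancel k 1, hadd, zpow_one] at hk⟩
  have hinv : α '' Wᶜ = Wᶜ := by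
    ext w
    obtain ⟨w, rfl⟩ := α.surjective w
    rw [α.injective.mem_set_image, Set.mem_compl_iff, Set.mem_compl_iff, hWα]
  have hcov : W = Set.univ := by
    rcases h Wᶜ (isOpen_iUnion hopen).isClosed_compl hinv with h1 | h1
    · exact Set.compl_empty_iff.mp h1
    · obtain ⟨o, ho⟩ := hne
      have h2 : o ∈ W := Set.mem_iUnion.mpr ⟨0, by simpa using ho⟩
      exact absurd h2 (h1.superset (Set.mem_univ o))
  obtain ⟨t, ht⟩ := isCompact_univ.elim_finite_subcover _ hopen hcov.superset
  -- Finitely many integer translates of `O` cover the space. Applying the cover to `α ^ N z` makes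
  -- the exponent nonnegative, which gives a forward visit.
  obtain ⟨N, hN⟩ : ∃ N : ℕ, ∀ k ∈ t, -(N : ℤ) ≤ k := by
    refine ⟨∑ k ∈ t, k.natAbs, fun k hk => ?_⟩
    have := Finset.single_le_sum (f := Int.natAbs) (fun _ _ => Nat.zero_le _) hk
    omega
  obtain ⟨k, hk, hkz⟩ := Set.mem_iUnion₂.mp (ht (Set.mem_univ ((α ^ (N : ℤ) : Z ≃ₜ Z) z)))
  obtain ⟨m, hm⟩ := Int.eq_ofNat_of_zero_le (a := k + N) (by have := hN k hk; omega)
  rw [Set.mem_preimage, ← hadd, hm, zpow_natCast, homeo_pow_apply] at hkz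
  exact ⟨m, hkz⟩

theorem IsMinimalHomeo.isSection [CompactSpace Z] (h : IsMinimalHomeo α) {D : Set Z}
    (hD : IsClopen D) (hne : D.Nonempty) : IsSection α D :=
  ⟨hD, h.exists_iterate_mem hD.isOpen hne, h.symm.exists_iterate_mem hD.isOpen hne⟩

/-- A periodic orbit would be finite, hence closed with nonempty complement in a perfect space, yet
the orbit must visit that complement. -/
theorem IsMinimalHomeo.iterate_ne [CompactSpace Z] [T1Space Z] [PerfectSpace Z]
    (h : IsMinimalHomeo α) (x : Z) {n : ℕ} (hn : 0 < n) : α^[n] x ≠ x := by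
  intro hx
  have hF : ((fun j => α^[j] x) '' Set.Iio n).Finite := (Set.finite_Iio n).image _
  have hne : ((fun j => α^[j] x) '' Set.Iio n)ᶜ.Nonempty := by
    by_contra hempty
    rw [Set.not_nonempty_iff_eq_empty, Set.compl_empty_iff] at hempty
    exact infinite_of_mem_nhds x univ_mem (hempty ▸ hF)
  obtain ⟨k, hk⟩ := h.exists_iterate_mem hF.isClosed.isOpen_compl hne x
  exact hk ⟨k % n, Nat.mod_lt _ hn, Function.IsPeriodicPt.iterate_mod_apply hx k⟩

theorem HasPhase.apply_iterate {p : ℕ} {φ : Z → ZMod p} (hφ : ∀ z, φ (α z) = φ z + 1) (n : ℕ)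
    (z : Z) : φ (α^[n] z) = φ z + n := by
  induction n with
  | zero => simp
  | succ n ih => rw [Function.iterate_succ_apply', hφ, ih]; push_cast; ring

theorem IsMinimalHomeo.exists_isClopen_of_large_return {Z : Type*} [MetricSpace Z]
    [CompactSpace Z] [TotallyDisconnectedSpace Z] [PerfectSpace Z] {α : Z ≃ₜ Z}
    (h : IsMinimalHomeo α) {O : Set Z} (hO : IsOpen O) {x : Z} (hx : x ∈ O) (N : ℕ) :
    ∃ C, IsClopen C ∧ x ∈ C ∧ C ⊆ O ∧ ∀ z ∈ C, ∀ k, 0 < k → k ≤ N → α^[k] z ∉ C := by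
  have hsep : ∀ k, ∃ U : Set Z, IsOpen U ∧ x ∈ U ∧ (0 < k → ∀ z ∈ U, α^[k] z ∉ U) := by
    intro k
    rcases Nat.eq_zero_or_pos k with rfl | hk
    · exact ⟨Set.univ, isOpen_univ, trivial, fun h => absurd h (lt_irrefl 0)⟩
    · obtain ⟨U, V, hU, hV, hxU, hxV, hUV⟩ := t2_separation (h.iterate_ne x hk).symm
      exact ⟨U ∩ α^[k] ⁻¹' V, hU.inter (hV.preimage (α.continuous.iterate k)), ⟨hxU, hxV⟩,
        fun _ z hz hz' => Set.disjoint_left.mp hUV hz'.1 hz.2⟩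
  choose U hU hxU hUk using hsep
  obtain ⟨C, hC, hxC, hCO⟩ := exists_isClopen_mem_subset
    (hO.inter (isOpen_biInter_finset (s := Finset.range (N + 1)) fun k _ => hU k))
    (x := x) ⟨hx, Set.mem_iInter₂.mpr fun k _ => hxU k⟩
  refine ⟨C, hC, hxC, fun z hz => (hCO hz).1, fun z hz k hk hkN hkz => ?_⟩
  have hmem : ∀ w ∈ C, w ∈ U k := fun w hw =>
    Set.mem_iInter₂.mp (hCO hw).2 k (Finset.mem_range.mpr (by omega))
  exact hUk k hk z (hmem z hz) (hmem _ hkz)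

end Minimal

/-! ### Cutting a long interval into blocks of prescribed lengths -/

section Tiling

/-- `k + s` is the element of `J` following `k`. -/
def IsGap (J : Set ℕ) (k s : ℕ) : Prop :=
  0 < s ∧ k + s ∈ J ∧ ∀ j, 0 < j → j < s → k + j ∉ J

/-- The partial sums of a list of positive numbers. -/
theorem exists_tiling (l : List ℕ) (hl : ∀ s ∈ l, 0 < s) :
    ∃ J : Set ℕ, 0 ∈ J ∧ (∀ k ∈ J, k ≤ l.sum) ∧ l.sum ∈ J ∧
      (∀ k ∈ J, k < l.sum → ∃ s ∈ l, IsGap J k s) ∧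
      ∀ s ∈ l, ∃ k ∈ J, k < l.sum ∧ IsGap J k s := by
  induction l with
  | nil => exact ⟨{0}, by simp⟩
  | cons x l ih =>
    obtain ⟨J, h0, hle, hsum, h1, h2⟩ := ih fun s hs => hl s (List.mem_cons_of_mem _ hs)
    have hx : 0 < x := hl x List.mem_cons_self
    have hmem : ∀ k, x + k ∈ insert 0 ((x + ·) '' J) ↔ k ∈ J := by
      intro k
      simp [hx.ne']
    have hlt : ∀ j, 0 < j → j < x → j ∉ insert 0 ((x + ·) '' J) := by
      rintro j hj hjx (rfl | ⟨k, -, rfl⟩)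
      · exact lt_irrefl 0 hj
      · exact absurd hjx (by simp)
    have hgap : ∀ k s, IsGap J k s → IsGap (insert 0 ((x + ·) '' J)) (x + k) s := by
      rintro k s ⟨hs, hks, hj⟩
      refine ⟨hs, by rwa [add_assoc, hmem], fun j hj0 hjs => ?_⟩
      rw [add_assoc, hmem]
      exact hj j hj0 hjs
    have hgap0 : IsGap (insert 0 ((x + ·) '' J)) 0 x := by
      refine ⟨hx, ?_, fun j hj hjx => ?_⟩
      · rw [zero_add]
        exact (hmem 0).mpr h0
      · rw [zero_add]
        exact hlt j hj hjx
    refine ⟨insert 0 ((x + ·) '' J), Set.mem_insert _ _, ?_, ?_, ?_, ?_⟩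
    · rintro _ (rfl | ⟨k, hk, rfl⟩)
      · exact Nat.zero_le _
      · simpa using hle k hk
    · rw [List.sum_cons, hmem]
      exact hsum
    · rintro _ (rfl | ⟨k, hk, rfl⟩) hlt'
      · exact ⟨x, List.mem_cons_self, hgap0⟩
      · obtain ⟨s, hs, hg⟩ := h1 k hk (by simpa using hlt')
        exact ⟨s, List.mem_cons_of_mem _ hs, hgap k s hg⟩
    · intro s hs
      rcases List.mem_cons.mp hs with rfl | hs
      · exact ⟨0, Set.mem_insert _ _, by simp [hx], hgap0⟩
      · obtain ⟨k, hk, hks, hg⟩ := h2 s hs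
        exact ⟨x + k, (hmem k).mpr hk, by simpa using hks, hgap k s hg⟩

theorem exists_list_sum_eq_of_setGcd_dvd {S : Set ℕ} (hS : S.Finite) :
    ∃ N, ∀ m ≥ N, Nat.setGcd S ∣ m →
      ∃ l : List ℕ, l.sum = m ∧ (∀ s ∈ l, s ∈ S) ∧ ∀ s ∈ S, s ∈ l := by
  obtain ⟨n, hn⟩ := Nat.exists_mem_closure_of_ge S
  set t := hS.toFinset.toList with ht
  have htS : ∀ s, s ∈ t ↔ s ∈ S := fun s => by simp [ht]
  -- One copy of each element of `S` is set aside, so that all are used. The remainder is still a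
  -- multiple of the gcd and at least `n`, hence a sum of elements of `S`.
  refine ⟨n + t.sum, fun m hm hdvd => ?_⟩
  have htd : Nat.setGcd S ∣ t.sum :=
    List.dvd_sum fun s hs => Nat.setGcd_dvd_of_mem ((htS s).mp hs)
  obtain ⟨l, hl, hsum⟩ := AddSubmonoid.exists_list_of_mem_closure
    (hn (m - t.sum) (by omega) (Nat.dvd_sub hdvd htd))
  refine ⟨t ++ l, by rw [List.sum_append, hsum]; omega, fun s hs => ?_, fun s hs => ?_⟩
  · rcases List.mem_append.mp hs with h | h
    · exact (htS s).mp h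
    · exact hl s h
  · exact List.mem_append_left _ ((htS s).mpr hs)

end Tiling

/-! ### The periodic spectrum classifies Cantor minimal systems -/

section CantorMinimal

variable {K : Type*} [MetricSpace K] [CompactSpace K] [TotallyDisconnectedSpace K]
  [PerfectSpace K]

/-- Take a clopen `C` inside one phase class with all return times at least `N`. Its towers have
heights divisible by the gcd, so each can be cut into blocks with lengths in `S`, every length being
used. `D` consists of the levels where blocks begin. -/
theorem IsMinimalHomeo.exists_section_returnTime [Nonempty K] {α : K ≃ₜ K}
    (hα : IsMinimalHomeo α) {S : Set ℕ} (hS : S.Finite) (hpos : ∀ s ∈ S, 0 < s)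
    (hphase : HasPhase α (Nat.setGcd S)) :
    ∃ D, IsSection α D ∧ returnTime α D '' D = S := by
  obtain ⟨φ, hφ, hstep⟩ := hphase
  obtain ⟨N, hN⟩ := exists_list_sum_eq_of_setGcd_dvd hS
  obtain ⟨x⟩ := ‹Nonempty K›
  obtain ⟨C, hC, hxC, hCφ, hCN⟩ :=
    hα.exists_isClopen_of_large_return (hφ.isOpen_fiber (φ x)) (x := x) rfl N
  have hCs : IsSection α C := hα.isSection hC ⟨x, hxC⟩
  have hret : ∀ c ∈ C, N ≤ returnTime α C c ∧ Nat.setGcd S ∣ returnTime α C c := by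
    intro c hc
    have hmem := hCs.iterate_returnTime_mem c
    constructor
    · by_contra! hlt
      exact hCN c hc _ returnTime_pos hlt.le hmem
    · have h1 := HasPhase.apply_iterate hstep (returnTime α C c) c
      have h2 : φ (α^[returnTime α C c] c) = φ x := hCφ hmem
      have h3 : φ c = φ x := hCφ hc
      rw [h2, h3, left_eq_add] at h1
      exact (ZMod.natCast_eq_zero_iff _ _).mp h1
  -- The tiling depends only on the height `m`, which makes `D` clopen. Inadmissible heights get the
  -- dummy value `∅`.
  have htile : ∀ m, ∃ J : Set ℕ, N ≤ m → Nat.setGcd S ∣ m → 0 ∈ J ∧ (∀ k ∈ J, k ≤ m) ∧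
      (∀ k ∈ J, k < m → ∃ s ∈ S, IsGap J k s) ∧ ∀ s ∈ S, ∃ k ∈ J, k < m ∧ IsGap J k s := by
    intro m
    by_cases hm : N ≤ m ∧ Nat.setGcd S ∣ m
    · obtain ⟨l, rfl, hlS, hSl⟩ := hN m hm.1 hm.2
      obtain ⟨J, h0, hle, -, h1, h2⟩ := exists_tiling l fun s hs => hpos s (hlS s hs)
      refine ⟨J, fun _ _ => ⟨h0, hle, fun k hk hkm => ?_, fun s hs => h2 s (hSl s hs)⟩⟩
      obtain ⟨s, hs, hg⟩ := h1 k hk hkm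
      exact ⟨s, hlS s hs, hg⟩
    · exact ⟨∅, fun h1 h2 => absurd ⟨h1, h2⟩ hm⟩
  choose J hJ using htile
  let height : K → ℕ := fun z => backTime α C z + returnTime α C z
  have hheight : ∀ z, N ≤ height z ∧ Nat.setGcd S ∣ height z := fun z => by
    simp only [height, hCs.backTime_add_returnTime z]
    exact hret _ (hCs.lastVisit_mem z)
  have hJh := fun z => hJ (height z) (hheight z).1 (hheight z).2
  let D : Set K := {z | backTime α C z ∈ J (height z)}
  have hlocal : IsLocallyConstant fun z => backTime α C z ∈ J (height z) :=
    (hCs.isLocallyConstant_backTime.prodMk hCs.isLocallyConstant_returnTime).comp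
      fun q : ℕ × ℕ => q.1 ∈ J (q.1 + q.2)
  have hDc : IsClopen D := by
    have : D = (fun z => backTime α C z ∈ J (height z)) ⁻¹' {True} := by
      ext z
      simp [D]
    rw [this]
    exact hlocal.isClopen_fiber True
  have hCD : C ⊆ D := fun z hz => by
    change backTime α C z ∈ J (height z)
    rw [backTime_of_mem hz]
    exact (hJh z).1
  have hiter : ∀ z j, j < returnTime α C z →
      (α^[j] z ∈ D ↔ backTime α C z + j ∈ J (height z)) := by
    intro z j hj
    obtain ⟨h1, h2⟩ := hCs.iterate_of_lt_returnTime z hj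
    have h3 : height (α^[j] z) = height z := by
      simp only [height]
      omega
    change backTime α C (α^[j] z) ∈ J (height (α^[j] z)) ↔ _
    rw [h1, h3]
  have hgap : ∀ z s, IsGap (J (height z)) (backTime α C z) s → returnTime α D z = s := by
    rintro z s ⟨hs, hmem, hnot⟩
    have hle : s ≤ returnTime α C z := by
      have := (hJh z).2.1 _ hmem
      simp only [height] at this
      omega
    refine returnTime_eq hs ?_ fun j hj hjs => ?_
    · rcases hle.lt_or_eq with h | h
      · exact (hiter z s h).mpr hmem
      -- The last block ends at the top of the tower, and the next point lies in `C ⊆ D`.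
      · rw [h]
        exact hCD (hCs.iterate_returnTime_mem z)
    · rw [hiter z j (by omega)]
      exact hnot j hj hjs
  refine ⟨D, hα.isSection hDc ⟨x, hCD hxC⟩, Set.Subset.antisymm ?_ ?_⟩
  · rintro _ ⟨z, hz, rfl⟩
    obtain ⟨s, hs, hg⟩ := (hJh z).2.2.1 _ hz
      (lt_add_of_pos_right (backTime α C z) (returnTime_pos (α := α) (D := C) (z := z)))
    rwa [hgap z s hg]
  · intro s hs
    have hx0 := backTime_of_mem (α := α) hxC
    -- The single tower over `x` already realises every `s ∈ S`.
    obtain ⟨k, hk, hkm, hg⟩ := (hJh x).2.2.2 s hs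
    have hkr : k < returnTime α C x := by
      simp only [height] at hkm
      omega
    obtain ⟨h1, h2⟩ := hCs.iterate_of_lt_returnTime x hkr
    have h3 : height (α^[k] x) = height x := by
      simp only [height]
      omega
    rw [hx0, zero_add] at h1
    refine ⟨α^[k] x, (hiter x k hkr).mpr (by rwa [hx0, zero_add]), hgap _ s ?_⟩
    rwa [h1, h3]

/-- The level modulo `p` is a phase: the drop from the top level to `0` is compatible with adding
one because the height is divisible by `p`. -/
theorem IsSection.hasPhase {Z : Type*} [TopologicalSpace Z] {β : Z ≃ₜ Z} {B : Set Z}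
    (hB : IsSection β B) {p : ℕ} (hp : ∀ b ∈ B, p ∣ returnTime β B b) : HasPhase β p := by
  refine ⟨fun z => (backTime β B z : ZMod p), hB.isLocallyConstant_backTime.comp _, fun z => ?_⟩
  change (backTime β B (β z) : ZMod p) = backTime β B z + 1
  by_cases hz : β z ∈ B
  · have h1 := hB.backTime_add_returnTime z
    rw [returnTime_of_apply_mem hz] at h1
    have h2 := (ZMod.natCast_eq_zero_iff _ _).mpr (h1 ▸ hp _ (hB.lastVisit_mem z))
    rw [backTime_of_mem hz]
    push_cast at h2 ⊢
    exact h2.symm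
  · rw [hB.backTime_apply hz]
    push_cast
    rfl

theorem approxBy_of_periodicSpectrum_subset [Nonempty K] {α β : K ≃ₜ K} (hα : IsMinimalHomeo α)
    (hβ : IsMinimalHomeo β) (h : periodicSpectrum β ⊆ periodicSpectrum α) :
    ApproxBy Set.univ α β := by
  rw [approxBy_iff_forall]
  intro ε hε
  obtain ⟨x⟩ := ‹Nonempty K›
  -- `B` and `β⁻¹(B)` lie in balls of radius `ε / 5`. Each supremum is then at most `2ε / 5`, and
  -- the total stays strictly below `ε`.
  have hε5 : 0 < ε / 5 := by positivity
  obtain ⟨B, hB, hxB, hBsub⟩ := exists_isClopen_mem_subset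
    ((Metric.isOpen_ball (x := x) (ε := ε / 5)).inter
      ((Metric.isOpen_ball (x := β.symm x) (ε := ε / 5)).preimage β.symm.continuous)) (x := x)
    ⟨Metric.mem_ball_self hε5, Metric.mem_ball_self hε5⟩
  have hd1 : ∀ y ∈ B, ∀ z ∈ B, dist y z ≤ 2 * (ε / 5) := fun y hy z hz => by
    have h1 := Metric.mem_ball.mp (hBsub hy).1
    have h2 := Metric.mem_ball.mp (hBsub hz).1
    have h3 := dist_triangle_right y z x
    linarith
  have hd2 : ∀ y ∈ B, ∀ z ∈ B, dist (β.symm y) (β.symm z) ≤ 2 * (ε / 5) := fun y hy z hz => by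
    have h1 := Metric.mem_ball.mp (hBsub hy).2
    have h2 := Metric.mem_ball.mp (hBsub hz).2
    have h3 := dist_triangle_right (β.symm y) (β.symm z) (β.symm x)
    linarith
  have hBs : IsSection β B := hβ.isSection hB ⟨x, hxB⟩
  set S : Set ℕ := returnTime β B '' B with hS
  have hSfin : S.Finite :=
    hBs.isLocallyConstant_returnTime.range_finite.subset (Set.image_subset_range _ _)
  have hSpos : ∀ s ∈ S, 0 < s := by
    rintro _ ⟨b, -, rfl⟩
    exact returnTime_pos
  have hgcd : 0 < Nat.setGcd S := by
    refine Nat.pos_of_ne_zero fun h0 => ?_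
    have h1 : returnTime β B x ∈ S := ⟨x, hxB, rfl⟩
    exact (hSpos _ h1).ne' (Nat.setGcd_eq_zero_iff.mp h0 h1)
  have hphase : HasPhase β (Nat.setGcd S) :=
    hBs.hasPhase fun b hb => Nat.setGcd_dvd_of_mem ⟨b, hb, rfl⟩
  have hphase' := (mem_periodicSpectrum_iff.mp (h (mem_periodicSpectrum_iff.mpr ⟨hgcd, hphase⟩))).2
  have : Nonempty K := ⟨x⟩
  obtain ⟨D, hD, hDS⟩ := hα.exists_section_returnTime hSfin hSpos hphase'
  have : CompactSpace D := isCompact_iff_compactSpace.mp hD.isClopen.isClosed.isCompact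
  have : CompactSpace B := isCompact_iff_compactSpace.mp hB.isClosed.isCompact
  have : PerfectSpace D := perfectSpace_of_isOpen hD.isClopen.isOpen
  have : PerfectSpace B := perfectSpace_of_isOpen hB.isOpen
  -- The colours are the return times, which take the same set of values `S` on `D` and on `B`.
  obtain ⟨f, hf⟩ := exists_homeomorph_of_coloring (X := D) (Y := B)
    (hD.isLocallyConstant_returnTime.comp_continuous continuous_subtype_val)
    (hBs.isLocallyConstant_returnTime.comp_continuous continuous_subtype_val)
    (by rw [Set.range_comp, Set.range_comp, Subtype.range_coe, Subtype.range_coe, hDS])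
  obtain ⟨σ, hσ⟩ := exists_homeomorph_of_sections hD hBs f hf
  refine ⟨σ, trivial, (homeo_dist_le (r := 2 * (ε / 5)) (s := 2 * (ε / 5)) (by positivity)
    (by positivity) (fun w => ?_) fun w => ?_).trans_lt (by linarith)⟩
  · obtain ⟨z, rfl⟩ := σ.surjective w
    have h1 : (σ * α * σ⁻¹) (σ z) = σ (α z) := by
      change σ (α (σ.symm (σ z))) = _
      rw [σ.symm_apply_apply]
    rw [h1]
    rcases hσ z with h2 | ⟨h2, h3⟩
    · rw [h2, dist_self]
      positivity
    · exact hd1 _ h2 _ h3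
  · obtain ⟨v, rfl⟩ := σ.surjective w
    obtain ⟨z, rfl⟩ := α.surjective v
    have h1 : (σ * α * σ⁻¹).symm (σ (α z)) = σ z := by
      change σ (α.symm (σ.symm (σ (α z)))) = _
      rw [σ.symm_apply_apply, α.symm_apply_apply]
    rw [h1]
    rcases hσ z with h2 | ⟨h2, h3⟩
    · rw [h2, β.symm_apply_apply, dist_self]
      positivity
    · have h4 := hd2 _ h3 _ h2
      rwa [β.symm_apply_apply] at h4

theorem weakApproxConj_of_periodicSpectrum_eq [Nonempty K] {α β : K ≃ₜ K}
    (hα : IsMinimalHomeo α) (hβ : IsMinimalHomeo β)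
    (h : periodicSpectrum α = periodicSpectrum β) : WeakApproxConj α β := by
  obtain ⟨σ, hσ, -⟩ := approxBy_iff_exists_seq.mp
    (approxBy_of_periodicSpectrum_subset hα hβ h.superset)
  obtain ⟨γ, hγ, -⟩ := approxBy_iff_exists_seq.mp
    (approxBy_of_periodicSpectrum_subset hβ hα h.subset)
  exact ⟨σ, γ, hσ, hγ⟩

end CantorMinimal

/-! ### Lifting from the base to the skew products -/

section SkewMinimal

variable {K Ω : Type*} [MetricSpace K] [CompactSpace K] [MetricSpace Ω] [CompactSpace Ω]

theorem periodicSpectrum_of_mem_R0 [ConnectedSpace Ω] {M : Set (Ω ≃ₜ Ω)} {s : K ≃ₜ K}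
    {α : K × Ω ≃ₜ K × Ω} (hα : α ∈ R0 M s) : periodicSpectrum α = periodicSpectrum s := by
  obtain ⟨⟨c, rfl⟩, -⟩ := hα
  exact periodicSpectrum_skewProduct s c

/-- The chain runs from `α` through `s × id` and `t × id` to `β`. Each witness serves only its own
end, so the two may differ. -/
theorem approxBy_isotopicSkew_of_mem_R0 {M₁ M₂ : Set (Ω ≃ₜ Ω)} (hM₁ : IsLMPWitness M₁)
    (hM₂ : IsLMPWitness M₂) {s t : K ≃ₜ K} {α β : K × Ω ≃ₜ K × Ω} (hα : α ∈ R0 M₁ s)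
    (hβ : β ∈ R0 M₂ t) (h : ApproxBy Set.univ s t) :
    ApproxBy (isotopicSkew K Ω : Set (K × Ω ≃ₜ K × Ω)) α β :=
  ((approxBy_prodId_of_mem_R0 hM₁ hα).trans h.prodId).trans (approxBy_of_mem_R0 hM₂ hβ)

end SkewMinimal

end ApproxConj

end

/-! ### The equivalences and the spectral criterion -/

theorem lemma6p10 {K Ω : Type*}
    [MetricSpace K] [CompactSpace K] [Nonempty K] [TotallyDisconnectedSpace K] [PerfectSpace K]
    [MetricSpace Ω] [CompactSpace Ω] [ConnectedSpace Ω]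
    (M₁ M₂ : Set (Ω ≃ₜ Ω)) (hM₁ : ApproxConj.IsLMPWitness M₁) (hM₂ : ApproxConj.IsLMPWitness M₂)
    (α' β' : K ≃ₜ K) (hα' : ApproxConj.IsMinimalHomeo α') (hβ' : ApproxConj.IsMinimalHomeo β')
    (α β : K × Ω ≃ₜ K × Ω) (hα : α ∈ ApproxConj.R0 M₁ α') (hβ : β ∈ ApproxConj.R0 M₂ β') :
    List.TFAE
      [ApproxConj.WeakApproxConj α β,
        ApproxConj.WeakApproxConj α' β',
        ∃ σ γ : ℕ → (K × Ω ≃ₜ K × Ω), ApproxConj.WeakApproxConjVia α β σ γ ∧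
          ∀ n, ApproxConj.HasQuasiTrivialCocycle (σ n) ∧
            ApproxConj.HasQuasiTrivialCocycle (γ n)] ∧
    (ApproxConj.WeakApproxConj α β ↔
      ApproxConj.periodicSpectrum α = ApproxConj.periodicSpectrum β) := by
  have hPα := ApproxConj.periodicSpectrum_of_mem_R0 hα
  have hPβ := ApproxConj.periodicSpectrum_of_mem_R0 hβ
  have h02 : ApproxConj.periodicSpectrum α = ApproxConj.periodicSpectrum β →
      ApproxConj.WeakApproxConj α' β' := fun h =>
    ApproxConj.weakApproxConj_of_periodicSpectrum_eq hα' hβ' (by rw [← hPα, ← hPβ, h])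
  have h23 : ApproxConj.WeakApproxConj α' β' →
      ∃ σ γ : ℕ → (K × Ω ≃ₜ K × Ω), ApproxConj.WeakApproxConjVia α β σ γ ∧
        ∀ n, ApproxConj.HasQuasiTrivialCocycle (σ n) ∧
          ApproxConj.HasQuasiTrivialCocycle (γ n) := by
    rintro ⟨σ', γ', hσ', hγ'⟩
    obtain ⟨σ, hσ, hσS⟩ := ApproxConj.approxBy_iff_exists_seq.mp
      (ApproxConj.approxBy_isotopicSkew_of_mem_R0 hM₁ hM₂ hα hβ
        (ApproxConj.approxBy_iff_exists_seq.mpr ⟨σ', hσ', fun _ => trivial⟩))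
    obtain ⟨γ, hγ, hγS⟩ := ApproxConj.approxBy_iff_exists_seq.mp
      (ApproxConj.approxBy_isotopicSkew_of_mem_R0 hM₂ hM₁ hβ hα
        (ApproxConj.approxBy_iff_exists_seq.mpr ⟨γ', hγ', fun _ => trivial⟩))
    exact ⟨σ, γ, ⟨hσ, hγ⟩, fun n =>
      ⟨ApproxConj.isotopicSkew_hasQuasiTrivialCocycle (hσS n),
        ApproxConj.isotopicSkew_hasQuasiTrivialCocycle (hγS n)⟩⟩
  have h31 : (∃ σ γ : ℕ → (K × Ω ≃ₜ K × Ω), ApproxConj.WeakApproxConjVia α β σ γ ∧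
      ∀ n, ApproxConj.HasQuasiTrivialCocycle (σ n) ∧ ApproxConj.HasQuasiTrivialCocycle (γ n)) →
      ApproxConj.WeakApproxConj α β := fun ⟨σ, γ, h, _⟩ => ⟨σ, γ, h⟩
  refine ⟨?_, fun h => h.periodicSpectrum_eq, fun h => h31 (h23 (h02 h))⟩
  tfae_have 1 → 2 := fun h => h02 h.periodicSpectrum_eq
  tfae_have 2 → 3 := h23
  tfae_have 3 → 1 := h31
  tfae_finish
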